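/- Let $E$ be a (real) Banach lattice with positive cone $E^+$ and norm dual $E'$, let $Y$ be a real Banach space, and let $T:E\to Y$ be a bounded linear operator. A net $(x_\alpha)$ in $E$ is uaw-convergent to $x\in E$ (written $x_\alpha\xrightarrow{uaw}x$) if $|x_\alpha-x|\wedge u\to 0$ weakly for every $u\in E^+$. A set $A\subset E$ is uaw-compact (respectively relatively uaw-compact) if every net in $A$ has a subnet that is uaw-convergent to a point of $A$ (respectively to a point of $E$). For $S\subset E$ let $\mathrm{sol}(S)=\{x\in E:\exists\, y\in S,\ |x|\le|y|\}$; for norm bounded $S$, the operator $T$ is called $S$-L-weakly compact if $\|T(x_n)\|\to0$ for every sequence $(x_n)\subset \mathrm{sol}(S)$ with $x_n\xrightarrow{uaw}0$. The operator $T$ is order weakly compact if $T([0,v])$ is relatively weakly compact in $Y$ for every $v\in E^+$. The following statements are equivalent: 1. $T$ is order weakly compact. 2. For every relatively compact subset $S$ of $E$, the operator $T$ is $S$-L-weakly compact. 3. For every $v\in E^+$, the operator $T$ is $\{v\}$-L-weakly compact. 4. For every $\varepsilon>0$ and $v\in E^+$ there exist a positive functional $g\in E'$ and $u\in E^+$ such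 that $\|T(x)\|\le g(|x|\wedge u)+\varepsilon$ for every $x\in[-v,v]$. 5. For every $v\in E^+$ and every net $(x_\alpha)\subset[-v,v]$ with $x_\alpha\xrightarrow{uaw}0$, one has $\|T(x_\alpha)\|\to0$. 6. For every $v\in E^+$ and every sequence $(x_n)\subset[-v,v]$ with $x_n\xrightarrow{uaw}0$, one has $\|T(x_n)\|\to0$. 7. For every order bounded uaw-compact subset $A$ of $E$, the set $T(A)$ is compact. 8. For every order bounded relatively uaw-compact subset $A$ of $E$, the set $T(A)$ is relatively compact. -/

import Mathlib

open Filter Topology Set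

universe u v w

section UnboundedAbsoluteWeak

/- Banach lattices are real: a complete normed space with a vector lattice order and a solid norm. -/
variable {E : Type u} [NormedAddCommGroup E] [NormedSpace ℝ E] [Lattice E]

/-- Unbounded absolute weak convergence (uaw-convergence) of the family `x` to `a` along the
filter `l`: for each `u ≥ 0`, the family `|x i - a| ∧ u` converges weakly to zero.
For a net or a sequence, `l` is `atTop`. -/
def UawTendsto {ι : Type*} (x : ι → E) (l : Filter ι) (a : E) : Prop :=
  ∀ u : E, 0 ≤ u → Tendsto (fun i => toWeakSpace ℝ E (|x i - a| ⊓ u)) l (𝓝 0)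

/-- The net `x` in `E` has a subnet which is uaw-convergent to `a`. A subnet of `x : ι → E` is a
net `x ∘ φ`, where `φ : κ → ι` is a map from a directed set such that for every `i₀` one has
`i₀ ≤ φ k` for all large enough `k`. -/
def HasSubnetUawTendsto {ι : Type u} [Preorder ι] (x : ι → E) (a : E) : Prop :=
  ∃ (κ : Type u) (_ : Preorder κ) (_ : IsDirectedOrder κ) (_ : Nonempty κ) (φ : κ → ι),
    Tendsto φ atTop atTop ∧ UawTendsto (x ∘ φ) atTop a

/-- `A` is uaw-compact: every net in `A` has a subnet which is uaw-convergent to a point of `A`.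
(Directed sets in the universe of `E` are enough to detect compactness of a subset of `E`.) -/
def UawCompact (A : Set E) : Prop :=
  ∀ (ι : Type u) [Preorder ι] [IsDirectedOrder ι] [Nonempty ι] (x : ι → E), (∀ i, x i ∈ A) →
    ∃ a ∈ A, HasSubnetUawTendsto x a

/-- `A` is relatively uaw-compact: every net in `A` has a subnet which is uaw-convergent in `E`. -/
def RelativelyUawCompact (A : Set E) : Prop :=
  ∀ (ι : Type u) [Preorder ι] [IsDirectedOrder ι] [Nonempty ι] (x : ι → E), (∀ i, x i ∈ A) →
    ∃ a : E, HasSubnetUawTendsto x a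

/-- `A` is order bounded: it is contained in an order interval. -/
def OrderBounded (A : Set E) : Prop :=
  ∃ a b : E, A ⊆ Icc a b

variable {Y : Type*} [NormedAddCommGroup Y] [NormedSpace ℝ Y]

/-- `T` is order weakly compact: `T [0, v]` is relatively weakly compact in `Y` for all `v ≥ 0`. -/
def OrderWeaklyCompact (T : E →L[ℝ] Y) : Prop :=
  ∀ v : E, 0 ≤ v → IsCompact (closure (toWeakSpace ℝ Y '' (T '' Icc 0 v)))

/-- `T` is `S`-L-weakly compact (for a norm bounded set `S`): `T` maps every uaw-null sequence in
the solid hull `{x | ∃ y ∈ S, |x| ≤ |y|}` of `S` to a norm null sequence. -/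
def SLWeaklyCompact (S : Set E) (T : E →L[ℝ] Y) : Prop :=
  ∀ x : ℕ → E, (∀ n, x n ∈ LatticeOrderedAddCommGroup.solidClosure S) → UawTendsto x atTop 0 →
    Tendsto (fun n => T (x n)) atTop (𝓝 0)

end UnboundedAbsoluteWeak

/-! ### Disjointness and scaling in vector lattices. -/

section VectorLattice

variable {E : Type*} [AddCommGroup E] [Lattice E]

/-! The hub is domination: up to ε, a positive functional g controls ‖T x‖ on each order interval.
It gives the convergence statements at once, as g(|x| ⊓ u) → 0 along uaw-null nets, and then the
compactness statements by passing to subnets. Conversely, the convergence statements force ‖T zₙ‖ →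
0 for order bounded disjoint sequences, which are uaw-null because ∑ g(zₙ ⊓ u) ≤ g u. The
compactness statements give convergence because a uaw-null sequence together with 0 is uaw-compact.
Two facts remain.

Disjoint nullity implies domination (`exists_nonneg_norm_apply_le_of_tendsto_of_disjoint`). If
domination fails on [0, p], elements xₙ with large images can be chosen successively so that earlier
witnessing functionals are tiny on later elements. Subtracting suitable multiples of the others from
each xᵢ makes finitely many of them disjoint without losing much. With enough of them, one can be
split off so that domination still fails on a disjoint remainder, and iteration gives an infinite
disjoint sequence with large images.

Order weak compactness fits in as follows. It implies disjoint nullity by Rosenthal's lemma and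
Mazur's theorem applied to partial sums (`OrderWeaklyCompact.tendsto_of_disjoint`). Domination
implies it because [0, v] behaves under g like an order interval of an L¹-space: a uniform convexity
estimate replaces weak compactness, and limits of f(T x) along an ultrafilter are norm limits of
evaluations at points T a. -/

lemma inf_eq_zero_of_le_of_le {x y a b : E} (hab : a ⊓ b = 0) (hx : 0 ≤ x) (hy : 0 ≤ y)
    (hxa : x ≤ a) (hyb : y ≤ b) : x ⊓ y = 0 :=
  le_antisymm ((inf_le_inf hxa hyb).trans hab.le) (le_inf hx hy)

section Scalar

variable [Module ℝ E] [IsOrderedModule ℝ E]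

lemma smul_sup_of_pos {r : ℝ} (hr : 0 < r) (a b : E) : r • (a ⊔ b) = r • a ⊔ r • b :=
  (OrderIso.smulRight (β := E) hr).map_sup a b

lemma smul_inf_of_pos {r : ℝ} (hr : 0 < r) (a b : E) : r • (a ⊓ b) = r • a ⊓ r • b :=
  (OrderIso.smulRight (β := E) hr).map_inf a b

lemma smul_posPart_of_pos {r : ℝ} (hr : 0 < r) (a : E) : (r • a)⁺ = r • a⁺ := by
  rw [posPart_def, posPart_def, smul_sup_of_pos hr, smul_zero]

lemma abs_smul_of_pos {r : ℝ} (hr : 0 < r) (a : E) : |r • a| = r • |a| := by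
  rw [abs, abs, smul_sup_of_pos hr, smul_neg]

end Scalar

variable [IsOrderedAddMonoid E]

lemma add_inf_le_inf_add_inf {a b c : E} (ha : 0 ≤ a) (hb : 0 ≤ b) (hc : 0 ≤ c) :
    (a + b) ⊓ c ≤ a ⊓ c + b ⊓ c := by
  rw [add_inf, inf_add, inf_add]
  refine le_inf (le_inf inf_le_left (inf_le_right.trans ?_)) (le_inf (inf_le_right.trans ?_) (inf_le_right.trans ?_))
  · exact le_add_of_nonneg_right hb
  · exact le_add_of_nonneg_left ha
  · exact le_add_of_nonneg_right hc

lemma Finset.sum_inf_eq_zero {ι : Type*} {s : Finset ι} {z : ι → E} {c : E}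
    (hz : ∀ i ∈ s, 0 ≤ z i) (hc : 0 ≤ c) (hd : ∀ i ∈ s, z i ⊓ c = 0) :
    (∑ i ∈ s, z i) ⊓ c = 0 := by
  classical
  induction s using Finset.induction_on with
  | empty => simpa using hc
  | insert i s hi ih =>
    rw [Finset.sum_insert hi]
    simp only [Finset.mem_insert, forall_eq_or_imp] at hz hd
    refine le_antisymm ?_ (le_inf (add_nonneg hz.1 (Finset.sum_nonneg hz.2)) hc)
    refine (add_inf_le_inf_add_inf hz.1 (Finset.sum_nonneg hz.2) hc).trans ?_
    rw [hd.1, ih hz.2 hd.2, add_zero]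

/-- A finite sum of pairwise disjoint positive elements is bounded by every common upper bound. -/
lemma Finset.sum_le_of_disjoint {ι : Type*} {s : Finset ι} {z : ι → E} {v : E} (hv : 0 ≤ v)
    (hz : ∀ i ∈ s, 0 ≤ z i) (hzv : ∀ i ∈ s, z i ≤ v)
    (hd : ∀ i ∈ s, ∀ j ∈ s, i ≠ j → z i ⊓ z j = 0) : ∑ i ∈ s, z i ≤ v := by
  classical
  induction s using Finset.induction_on with
  | empty => simpa using hv
  | insert i s hi ih =>
    rw [Finset.sum_insert hi]
    simp only [Finset.mem_insert, forall_eq_or_imp] at hz hzv hd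
    have h0 : (∑ j ∈ s, z j) ⊓ z i = 0 := by
      refine Finset.sum_inf_eq_zero hz.2 hz.1 fun j hj => (hd.2 j hj).1 ?_
      rintro rfl
      exact hi hj
    have h1 := inf_add_sup (∑ j ∈ s, z j) (z i)
    rw [h0, zero_add] at h1
    rw [add_comm, ← h1]
    exact sup_le (ih hz.2 hzv.2 fun j hj k hk => (hd.2 j hj).2 k hk) hzv.1

lemma sub_posPart_sub {x y : E} : x - (x - y)⁺ = x ⊓ y := by
  rw [inf_eq_sub_posPart_sub]

variable [Module ℝ E] [IsOrderedModule ℝ E]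

/-- The second element is r⁻¹ times the negative part of a - r • b. This is how disjoint elements
are manufactured below: reciprocal coefficients give disjointness. -/
lemma posPart_sub_smul_inf_posPart_sub_smul {r : ℝ} (hr : 0 < r) (a b : E) :
    (a - r • b)⁺ ⊓ (b - r⁻¹ • a)⁺ = 0 := by
  have h : (b - r⁻¹ • a)⁺ = r⁻¹ • (a - r • b)⁻ := by
    rw [← posPart_neg, ← smul_posPart_of_pos (inv_pos.2 hr), neg_sub, smul_sub,
      inv_smul_smul₀ hr.ne']
  rw [h]
  set c := a - r • b
  have hs : c⁺ ⊓ r⁻¹ • c⁻ ≤ (1 + r⁻¹) • (c⁺ ⊓ c⁻) := by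
    rw [smul_inf_of_pos (by positivity)]
    refine inf_le_inf ?_ ?_
    · rw [add_smul, one_smul]
      exact le_add_of_nonneg_right (smul_nonneg (by positivity) (posPart_nonneg _))
    · rw [add_smul, one_smul]
      exact le_add_of_nonneg_left (negPart_nonneg _)
  rw [posPart_inf_negPart_eq_zero, smul_zero] at hs
  exact le_antisymm hs (le_inf (posPart_nonneg _) (smul_nonneg (by positivity) (negPart_nonneg _)))

end VectorLattice

/-! ### Positive functionals dominating a given functional. -/

section DominatingFunctional

variable {E : Type*} [NormedAddCommGroup E] [Lattice E] [IsOrderedAddMonoid E]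

lemma norm_le_norm_of_nonneg_of_le [HasSolidNorm E] {a b : E} (ha : 0 ≤ a) (hab : a ≤ b) : ‖a‖ ≤ ‖b‖ :=
  norm_le_norm_of_abs_le_abs (abs_le_abs_of_nonneg ha hab)

variable [NormedSpace ℝ E]

lemma StrongDual.mono_of_nonneg {g : StrongDual ℝ E} (hg : ∀ x, 0 ≤ x → 0 ≤ g x) {x y : E}
    (h : x ≤ y) : g x ≤ g y := by
  have := hg _ (sub_nonneg.2 h)
  rw [map_sub] at this
  linarith

variable [IsOrderedModule ℝ E] [HasSolidNorm E]

/-- Every continuous functional on a normed lattice is dominated by a positive one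
which is not larger in norm. -/
theorem StrongDual.exists_nonneg_abs_apply_le (f : StrongDual ℝ E) :
    ∃ g : StrongDual ℝ E, (∀ x, 0 ≤ x → 0 ≤ g x) ∧ (∀ x, |f x| ≤ g |x|) ∧ ‖g‖ ≤ ‖f‖ := by
  -- Hahn–Banach on E × E extends f from {0} × E below N, and g is minus the extension on E × {0}. N
  -- vanishes at (x, 0) for x ≥ 0, which gives positivity, and at (|y|, y), which gives domination.
  let N : E × E → ℝ := fun p => ‖f‖ * ‖(|p.2| - p.1)⁺‖
  let F : (E × E) →ₗ.[ℝ] ℝ :=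
    { domain := Submodule.prod ⊥ ⊤
      toFun := (f : E →ₗ[ℝ] ℝ) ∘ₗ LinearMap.snd ℝ E E ∘ₗ Submodule.subtype _ }
  obtain ⟨Φ, hΦF, hΦN⟩ := exists_extension_of_le_sublinear F N
    (by
      intro c hc p
      simp only [N, Prod.smul_snd, Prod.smul_fst]
      rw [abs_smul_of_pos hc, ← smul_sub, smul_posPart_of_pos hc, norm_smul, Real.norm_of_nonneg hc.le]
      ring)
    (by
      intro p q
      simp only [N, Prod.snd_add, Prod.fst_add, ← mul_add]
      refine mul_le_mul_of_nonneg_left (le_trans ?_ (norm_add_le _ _)) (norm_nonneg _)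
      refine norm_le_norm_of_nonneg_of_le (posPart_nonneg _) ?_
      refine sup_le ?_ (add_nonneg (posPart_nonneg _) (posPart_nonneg _))
      calc |p.2 + q.2| - (p.1 + q.1) ≤ (|p.2| + |q.2|) - (p.1 + q.1) :=
            sub_le_sub_right (abs_add_le _ _) _
        _ = (|p.2| - p.1) + (|q.2| - q.1) := by abel
        _ ≤ _ := add_le_add (le_posPart _) (le_posPart _))
    (by
      rintro ⟨⟨a, b⟩, hab⟩
      have ha : a = 0 := by
        have := (Submodule.mem_prod.1 hab).1
        simpa using this
      subst ha
      simp only [F, N, LinearMap.coe_comp, Function.comp_apply, LinearPMap.mk_apply,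
        Submodule.coe_subtype, LinearMap.snd_apply, sub_zero, ContinuousLinearMap.coe_coe]
      rw [posPart_eq_self.2 (abs_nonneg b), norm_abs_eq_norm]
      exact (le_abs_self _).trans (f.le_opNorm b))
  have hΦf : ∀ y, Φ (0, y) = f y := fun y =>
    hΦF ⟨(0, y), Submodule.mem_prod.2 ⟨by simp, trivial⟩⟩
  have hN : ∀ x : E, |Φ (x, 0)| ≤ ‖f‖ * ‖x‖ := by
    have key : ∀ x : E, Φ (x, 0) ≤ ‖f‖ * ‖x‖ := by
      intro x
      refine (hΦN (x, 0)).trans (mul_le_mul_of_nonneg_left ?_ (norm_nonneg _))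
      rw [← norm_abs_eq_norm x]
      refine norm_le_norm_of_nonneg_of_le (posPart_nonneg _) (sup_le ?_ (abs_nonneg _))
      simpa using neg_le_abs x
    intro x
    refine abs_le'.2 ⟨key x, ?_⟩
    have := key (-x)
    rw [norm_neg, show ((-x, 0) : E × E) = -(x, 0) by simp, map_neg] at this
    exact this
  let g : StrongDual ℝ E := LinearMap.mkContinuous (-(Φ ∘ₗ LinearMap.inl ℝ E E)) ‖f‖ (by
    intro x
    simpa using hN x)
  have hg : ∀ x, g x = -Φ (x, 0) := fun x => rfl
  have hle : ∀ y : E, f y ≤ g |y| := by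
    intro y
    have h1 : Φ (|y|, y) ≤ 0 := by simpa [N] using hΦN (|y|, y)
    have h2 : Φ (|y|, y) = Φ (|y|, 0) + Φ (0, y) := by rw [← map_add]; simp
    rw [hg, ← hΦf]
    linarith
  refine ⟨g, fun x hx => ?_, fun x => abs_le'.2 ⟨hle x, ?_⟩,
    LinearMap.mkContinuous_norm_le _ (norm_nonneg _) _⟩
  · have h1 := hΦN (x, 0)
    have h2 : (|(0 : E)| - x)⁺ = 0 := by
      rw [posPart_eq_zero]; simpa using hx
    simp only [N, h2, norm_zero, mul_zero] at h1
    rw [hg]; linarith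
  · simpa using hle (-x)

end DominatingFunctional

/-! ### Uniform convexity and an L¹-type compactness of order intervals. -/

section OrderIntervalCompactness

variable {E : Type*} [NormedAddCommGroup E] [NormedSpace ℝ E] [Lattice E] [IsOrderedAddMonoid E]
  [IsOrderedModule ℝ E]

/-- Pointwise, a value between 0 and n • w lies within w of some grid point k • w; beyond the grid,
the distance to its last point remains. -/
lemma le_sup_sub_smul_of_forall_le_abs_sub_smul {c w d : E} (hc : 0 ≤ c) (hw : 0 ≤ w) (n : ℕ)
    (hd : ∀ k ≤ n, d ≤ |c - (k : ℝ) • w|) : d ≤ w ⊔ (c - (n : ℝ) • w) := by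
  induction n with
  | zero =>
    have := hd 0 le_rfl
    simp only [CharP.cast_eq_zero, zero_smul, sub_zero, abs_of_nonneg hc] at this ⊢
    exact this.trans le_sup_right
  | succ n ih =>
    have h1 := ih fun k hk => hd k (hk.trans n.le_succ)
    have h2 := hd (n + 1) le_rfl
    set e := c - ((n + 1 : ℕ) : ℝ) • w with he
    have he' : c - (n : ℝ) • w = e + w := by
      rw [he]; push_cast; rw [add_smul, one_smul]; abel
    rw [he'] at h1
    -- Twice this infimum is at most the sum of its two terms, which is w.
    have hneg : (e + w) ⊓ -e ≤ w := by
      set m := (e + w) ⊓ -e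
      have h3 : m + m ≤ w := by
        calc m + m ≤ (e + w) + -e := add_le_add inf_le_left inf_le_right
          _ = w := by abel
      have h4 : (2⁻¹ : ℝ) • (m + m) ≤ (2⁻¹ : ℝ) • w := smul_le_smul_of_nonneg_left h3 (by norm_num)
      have h5 : (2⁻¹ : ℝ) • (m + m) = m := by rw [← two_smul ℝ m, inv_smul_smul₀ two_ne_zero]
      rw [h5] at h4
      refine h4.trans ?_
      calc (2⁻¹ : ℝ) • w ≤ (1 : ℝ) • w := smul_le_smul_of_nonneg_right (by norm_num) hw
        _ = w := one_smul _ _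
    let _ : DistribLattice E := AddCommGroup.toDistribLattice E
    calc d ≤ (w ⊔ (e + w)) ⊓ |e| := le_inf h1 h2
      _ = (w ⊓ |e|) ⊔ ((e + w) ⊓ (e ⊔ -e)) := by rw [inf_sup_right]; rfl
      _ = (w ⊓ |e|) ⊔ (((e + w) ⊓ e) ⊔ ((e + w) ⊓ -e)) := by rw [inf_sup_left (e + w) e (-e)]
      _ ≤ w ⊔ e := sup_le (inf_le_left.trans le_sup_left)
          (sup_le (inf_le_right.trans le_sup_right) (hneg.trans le_sup_left))

/-- A uniform convexity inequality for the convex function `x ↦ ∑ k ≤ n, g |x - k • w|` on the order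
interval `[0, n • w]`. -/
lemma StrongDual.apply_abs_sub_le_sum {g : StrongDual ℝ E} (hg : ∀ x, 0 ≤ x → 0 ≤ g x)
    {w x y : E} (n : ℕ) (hw : 0 ≤ w) (hx : x ∈ Icc 0 ((n : ℝ) • w)) (hy : y ∈ Icc 0 ((n : ℝ) • w)) :
    g |x - y| ≤ ∑ k ∈ Finset.range (n + 1), g |x - (k : ℝ) • w|
      + ∑ k ∈ Finset.range (n + 1), g |y - (k : ℝ) • w|
      - 2 * ∑ k ∈ Finset.range (n + 1), g |(2⁻¹ : ℝ) • (x + y) - (k : ℝ) • w| + 2 * g w := by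
  set c := (2⁻¹ : ℝ) • (x + y) with hcdef
  have h2c : (2 : ℝ) • c = x + y := by rw [hcdef, smul_inv_smul₀ two_ne_zero]
  have hc0 : 0 ≤ c := smul_nonneg (by norm_num) (add_nonneg hx.1 hy.1)
  have hcn : c ≤ (n : ℝ) • w := by
    have : (2⁻¹ : ℝ) • (x + y) ≤ (2⁻¹ : ℝ) • ((n : ℝ) • w + (n : ℝ) • w) :=
      smul_le_smul_of_nonneg_left (add_le_add hx.2 hy.2) (by norm_num)
    rwa [← two_smul ℝ ((n : ℝ) • w), inv_smul_smul₀ two_ne_zero] at this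
  let D : ℕ → E := fun k => |x - (k : ℝ) • w| + |y - (k : ℝ) • w| - (2 : ℝ) • |c - (k : ℝ) • w|
  have habs : ∀ k : ℕ, (2 : ℝ) • |c - (k : ℝ) • w| = |(x - (k : ℝ) • w) + (y - (k : ℝ) • w)| := by
    intro k
    rw [← abs_smul_of_pos two_pos, smul_sub, h2c, two_smul]
    congr 1; abel
  have hD : ∀ k, 0 ≤ D k := by
    intro k
    simp only [D, habs]
    exact sub_nonneg.2 (abs_add_le _ _)
  set S := ∑ k ∈ Finset.range (n + 1), D k with hS
  -- |x - y| ≤ D k + 2|c - k • w| for every k, so the grid lemma bounds the left side by w.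
  have hk : ∀ k ≤ n, (2⁻¹ : ℝ) • (|x - y| - S) ≤ |c - (k : ℝ) • w| := by
    intro k hk
    have h1 : D k ≤ S := Finset.single_le_sum (fun i _ => hD i)
      (Finset.mem_range.2 (Nat.lt_succ_of_le hk))
    have h2 : |x - y| ≤ |x - (k : ℝ) • w| + |y - (k : ℝ) • w| := by
      have := abs_add_le (x - (k : ℝ) • w) (-(y - (k : ℝ) • w))
      rw [abs_neg] at this
      convert this using 2
      abel
    have h3 : |x - y| - S ≤ (2 : ℝ) • |c - (k : ℝ) • w| := by
      calc |x - y| - S ≤ (|x - (k : ℝ) • w| + |y - (k : ℝ) • w|) - D k := sub_le_sub h2 h1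
        _ = _ := by simp only [D]; abel
    have h4 := smul_le_smul_of_nonneg_left h3 (by norm_num : (0 : ℝ) ≤ 2⁻¹)
    rwa [inv_smul_smul₀ two_ne_zero] at h4
  have h5 := le_sup_sub_smul_of_forall_le_abs_sub_smul hc0 hw n hk
  rw [sup_eq_left.2 ((sub_nonpos.2 hcn).trans hw)] at h5
  have h6 := smul_le_smul_of_nonneg_left h5 (by norm_num : (0 : ℝ) ≤ 2)
  rw [smul_inv_smul₀ two_ne_zero, sub_le_iff_le_add] at h6
  have h7 := StrongDual.mono_of_nonneg hg h6
  have h8 : g S = ∑ k ∈ Finset.range (n + 1), g |x - (k : ℝ) • w|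
      + ∑ k ∈ Finset.range (n + 1), g |y - (k : ℝ) • w|
      - 2 * ∑ k ∈ Finset.range (n + 1), g |c - (k : ℝ) • w| := by
    simp only [hS, D, map_sum, map_add, map_sub, map_smul, smul_eq_mul, Finset.sum_add_distrib,
      Finset.sum_sub_distrib, Finset.mul_sum]
  rw [map_add, map_smul, smul_eq_mul, h8] at h7
  linarith

/-- A form of the weak compactness of order intervals in an `L¹`-space: for a filter on an order
interval and a positive functional `g`, some point is `g`-close to the convex hulls of all members
of the filter. -/
theorem exists_mem_Icc_forall_exists_mem_convexHull {g : StrongDual ℝ E}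
    (hg : ∀ x, 0 ≤ x → 0 ≤ g x) {v : E} (hv : 0 ≤ v) {l : Filter E} [l.NeBot] (hl : Icc 0 v ∈ l)
    {δ : ℝ} (hδ : 0 < δ) :
    ∃ a ∈ Icc 0 v, ∀ U ∈ l, ∃ x ∈ convexHull ℝ U ∩ Icc 0 v, g |x - a| ≤ δ := by
  -- The mesh v / n makes the error 2 g w at most δ / 2; the near-minimality errors below contribute
  -- the other δ / 2.
  obtain ⟨n, hn⟩ := exists_nat_gt (4 * g v / δ)
  have hn0 : (0 : ℝ) < n := lt_of_le_of_lt (div_nonneg (mul_nonneg (by norm_num) (hg v hv)) hδ.le) hn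
  set w := (n : ℝ)⁻¹ • v with hwdef
  have hw : 0 ≤ w := smul_nonneg (by positivity) hv
  have hnw : (n : ℝ) • w = v := smul_inv_smul₀ hn0.ne' v
  have hgw : 4 * g w ≤ δ := by
    rw [hwdef, map_smul, smul_eq_mul]
    rw [div_lt_iff₀ hδ] at hn
    rw [mul_left_comm, inv_mul_le_iff₀ hn0]
    linarith
  let Ψ : E → ℝ := fun x => ∑ k ∈ Finset.range (n + 1), g |x - (k : ℝ) • w|
  have hΨ0 : ∀ x, 0 ≤ Ψ x := fun x => Finset.sum_nonneg fun k _ => hg _ (abs_nonneg _)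
  have hΨB : ∀ x ∈ Icc 0 v, Ψ x ≤ (n + 1) * g v := by
    intro x hx
    have : ∀ k ∈ Finset.range (n + 1), g |x - (k : ℝ) • w| ≤ g v := by
      intro k hk
      have hk' : (k : ℝ) ≤ n := by exact_mod_cast Nat.lt_succ_iff.1 (Finset.mem_range.1 hk)
      have h0 : 0 ≤ (k : ℝ) • w := smul_nonneg (by positivity) hw
      have h1 : (k : ℝ) • w ≤ v := by
        rw [← hnw]; exact smul_le_smul_of_nonneg_right hk' hw
      refine StrongDual.mono_of_nonneg hg (abs_le'.2 ⟨?_, ?_⟩)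
      · exact (sub_le_self _ h0).trans hx.2
      · rw [neg_sub]; exact (sub_le_self _ hx.1).trans h1
    calc Ψ x ≤ ∑ k ∈ Finset.range (n + 1), g v := Finset.sum_le_sum this
      _ = _ := by simp
  have hconv : ∀ U ⊆ Icc 0 v, convexHull ℝ U ⊆ Icc 0 v :=
    fun U hU => convexHull_min hU (convex_Icc _ _)
  -- The supremum of R is the limit of the infima of Ψ over convex hulls of members of l.
  -- Near-minimisers are g-close, since their midpoint stays in the hull of U₀.
  let R : Set ℝ := {r | ∃ U ∈ l, U ⊆ Icc 0 v ∧ ∀ x ∈ convexHull ℝ U, r ≤ Ψ x}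
  have hRne : R.Nonempty := ⟨0, Icc 0 v, hl, subset_rfl, fun x _ => hΨ0 x⟩
  have hRbdd : BddAbove R := by
    refine ⟨(n + 1) * g v, ?_⟩
    rintro r ⟨U, hU, hUv, hr⟩
    obtain ⟨x, hx⟩ := Filter.nonempty_of_mem hU
    exact (hr x (subset_convexHull ℝ U hx)).trans (hΨB x (hUv hx))
  obtain ⟨r, ⟨U₀, hU₀, hU₀v, hr⟩, hrm⟩ :=
    exists_lt_of_lt_csSup hRne (sub_lt_self (sSup R) (by positivity : 0 < δ / 8))
  have hex : ∀ U ∈ l, ∃ x ∈ convexHull ℝ (U ∩ U₀), Ψ x < sSup R + δ / 8 := by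
    intro U hU
    by_contra! hcon
    have : sSup R + δ / 8 ∈ R :=
      ⟨U ∩ U₀, inter_mem hU hU₀, inter_subset_right.trans hU₀v, hcon⟩
    have := le_csSup hRbdd this
    linarith
  obtain ⟨a, ha, haΨ⟩ := hex U₀ hU₀
  rw [inter_self] at ha
  refine ⟨a, hconv _ hU₀v ha, fun U hU => ?_⟩
  obtain ⟨x, hx, hxΨ⟩ := hex U hU
  have hx₀ : x ∈ convexHull ℝ U₀ := convexHull_mono inter_subset_right hx
  refine ⟨x, ⟨convexHull_mono inter_subset_left hx, hconv _ hU₀v hx₀⟩, ?_⟩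
  have hmid : (2⁻¹ : ℝ) • (x + a) ∈ convexHull ℝ U₀ := by
    rw [smul_add]
    exact convex_convexHull ℝ U₀ hx₀ ha (by norm_num) (by norm_num) (by norm_num)
  have h1 := hr _ hmid
  have h2 := StrongDual.apply_abs_sub_le_sum hg (w := w) (x := x) (y := a) n hw
    (by rw [hnw]; exact hconv _ hU₀v hx₀) (by rw [hnw]; exact hconv _ hU₀v ha)
  simp only [Ψ] at h1 hxΨ haΨ
  linarith

end OrderIntervalCompactness

/-! ### Relative weak compactness from domination. -/

section Compactness

/-- An ultrafilter on the closure is shadowed by one on s, refining the traces on s of its open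
members; regularity transfers the limit back. -/
lemma isCompact_closure_of_forall_ultrafilter {X : Type*} [TopologicalSpace X] [RegularSpace X]
    {s : Set X} (h : ∀ F : Ultrafilter X, s ∈ F → ∃ x, (F : Filter X) ≤ 𝓝 x) :
    IsCompact (closure s) := by
  rw [isCompact_iff_ultrafilter_le_nhds']
  intro F hF
  let G : Filter X := (⨅ O : {O : Set X // IsOpen O ∧ O ∈ F}, 𝓟 (O.1 ∩ s))
  have hdir : Directed (· ≥ ·) fun O : {O : Set X // IsOpen O ∧ O ∈ F} => 𝓟 (O.1 ∩ s) := by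
    rintro ⟨O, hO, hOF⟩ ⟨O', hO', hOF'⟩
    refine ⟨⟨O ∩ O', hO.inter hO', inter_mem hOF hOF'⟩, ?_, ?_⟩
    · exact principal_mono.2 (inter_subset_inter_left _ inter_subset_left)
    · exact principal_mono.2 (inter_subset_inter_left _ inter_subset_right)
  have : Nonempty {O : Set X // IsOpen O ∧ O ∈ F} := ⟨⟨univ, isOpen_univ, univ_mem⟩⟩
  have : G.NeBot := by
    refine iInf_neBot_of_directed' hdir ?_
    rintro ⟨O, hO, hOF⟩
    rw [principal_neBot_iff]
    obtain ⟨x, hxO, hxs⟩ := F.nonempty_of_mem (inter_mem hOF hF)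
    exact mem_closure_iff.1 hxs O hO hxO
  have hGO : ∀ O, IsOpen O → O ∈ F → O ∩ s ∈ G := fun O hO hOF =>
    mem_iInf_of_mem ⟨O, hO, hOF⟩ (mem_principal_self _)
  let H := Ultrafilter.of G
  have hHG : (H : Filter X) ≤ G := Ultrafilter.of_le G
  have hsH : s ∈ H := by
    have := hHG (hGO univ isOpen_univ univ_mem)
    rwa [univ_inter] at this
  obtain ⟨x, hx⟩ := h H hsH
  have hFx : (F : Filter X) ≤ 𝓝 x := by
    intro V hV
    obtain ⟨C, hC, hCc, hCV⟩ := exists_mem_nhds_isClosed_subset hV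
    by_contra hVF
    have hCF : Cᶜ ∈ F := by
      rw [Ultrafilter.compl_mem_iff_notMem]
      exact fun h' => hVF (mem_of_superset h' hCV)
    have h1 : Cᶜ ∩ s ∈ H := hHG (hGO _ hCc.isOpen_compl hCF)
    have h2 : C ∈ H := hx hC
    obtain ⟨y, hy, hy'⟩ := H.nonempty_of_mem (inter_mem h1 h2)
    exact hy.1 hy'
  refine ⟨x, ?_, hFx⟩
  exact isClosed_closure.mem_of_frequently_of_tendsto (f := id) (b := (F : Filter X))
    (Eventually.frequently hF) hFx

lemma tendsto_toWeakSpace_iff {Y : Type*} [NormedAddCommGroup Y] [NormedSpace ℝ Y] {α : Type*}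
    {l : Filter α} {x : α → Y} {y : Y} :
    Tendsto (fun a => toWeakSpace ℝ Y (x a)) l (𝓝 (toWeakSpace ℝ Y y)) ↔
      ∀ f : StrongDual ℝ Y, Tendsto (fun a => f (x a)) l (𝓝 (f y)) := by
  refine WeakBilin.tendsto_iff_forall_eval_tendsto (topDualPairing ℝ Y).flip ?_
  intro a b hab
  refine SeparatingDual.eq_iff_forall_dual_eq (R := ℝ) |>.2 fun f => ?_
  exact LinearMap.congr_fun hab f

/-- If `T` is, up to `ε`, dominated on order intervals by positive functionals, then
`T` maps order intervals to relatively weakly compact sets. -/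
theorem orderWeaklyCompact_of_forall_exists_norm_apply_le
    {E : Type*} [NormedAddCommGroup E] [NormedSpace ℝ E] [Lattice E] [IsOrderedAddMonoid E]
    [IsOrderedModule ℝ E]
    {Y : Type*} [NormedAddCommGroup Y] [NormedSpace ℝ Y] [CompleteSpace Y] (T : E →L[ℝ] Y)
    (h : ∀ ε : ℝ, 0 < ε → ∀ v : E, 0 ≤ v → ∃ g : StrongDual ℝ E, (∀ x : E, 0 ≤ x → 0 ≤ g x) ∧
      ∀ x ∈ Icc (-v) v, ‖T x‖ ≤ g |x| + ε) : OrderWeaklyCompact T := by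
  intro v hv
  refine isCompact_closure_of_forall_ultrafilter fun F hF => ?_
  rw [image_image] at hF
  let 𝒰 := Ultrafilter.ofComapInfPrincipal hF
  have h𝒰 : Icc 0 v ∈ 𝒰 := Ultrafilter.ofComapInfPrincipal_mem hF
  have hmap : 𝒰.map (fun x => toWeakSpace ℝ Y (T x)) = F := Ultrafilter.ofComapInfPrincipal_eq_of_map hF
  have hlim : ∀ f : StrongDual ℝ Y, ∃ L : ℝ, Tendsto (fun x => f (T x)) 𝒰 (𝓝 L) := by
    intro f
    obtain ⟨g, hg, hgT⟩ := h 1 one_pos v hv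
    have hmem : Metric.closedBall (0 : ℝ) (‖f‖ * (g v + 1)) ∈ 𝒰.map fun x => f (T x) := by
      rw [Ultrafilter.mem_map]
      refine mem_of_superset h𝒰 fun x hx => ?_
      rw [mem_preimage, mem_closedBall_zero_iff]
      refine (f.le_opNorm _).trans (mul_le_mul_of_nonneg_left ?_ (norm_nonneg _))
      refine (hgT x ⟨(neg_nonpos.2 hv).trans hx.1, hx.2⟩).trans ?_
      rw [abs_of_nonneg hx.1]
      have := StrongDual.mono_of_nonneg hg hx.2
      linarith
    obtain ⟨r, -, hr⟩ := (isCompact_closedBall (0 : ℝ) _).ultrafilter_le_nhds' _ hmem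
    exact ⟨r, hr⟩
  choose L hL using hlim
  -- The point a does not depend on f; this uniformity makes the T (a n) Cauchy, and their limit
  -- represents L.
  have hex : ∀ δ : ℝ, 0 < δ → ∃ a : E, ∀ f : StrongDual ℝ Y, |L f - f (T a)| ≤ ‖f‖ * δ := by
    intro δ hδ
    obtain ⟨g, hg, hgT⟩ := h (δ / 2) (half_pos hδ) v hv
    obtain ⟨a, ha, haU⟩ := exists_mem_Icc_forall_exists_mem_convexHull hg hv (l := 𝒰) h𝒰 (half_pos hδ)
    refine ⟨a, fun f => le_of_forall_pos_le_add fun η hη => ?_⟩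
    obtain ⟨x, ⟨hx, hxv⟩, hxa⟩ := haU _ (hL f (Metric.closedBall_mem_nhds (L f) hη))
    have hx' : f (T x) ∈ Metric.closedBall (L f) η := by
      have hc : Convex ℝ ((fun x => f (T x)) ⁻¹' Metric.closedBall (L f) η) :=
        (convex_closedBall (L f) η).linear_preimage ((f.comp T : StrongDual ℝ E) : E →ₗ[ℝ] ℝ)
      exact convexHull_min subset_rfl hc hx
    rw [Metric.mem_closedBall, Real.dist_eq] at hx'
    have h1 : ‖T (x - a)‖ ≤ δ := by
      have := hgT (x - a) ⟨by
        rw [neg_le, neg_sub]; exact (sub_le_self _ hxv.1).trans ha.2, (sub_le_self _ ha.1).trans hxv.2⟩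
      linarith
    have h2 : |f (T x) - f (T a)| ≤ ‖f‖ * δ := by
      rw [← map_sub, ← map_sub]
      exact (f.le_opNorm _).trans (mul_le_mul_of_nonneg_left h1 (norm_nonneg _))
    calc |L f - f (T a)| ≤ |L f - f (T x)| + |f (T x) - f (T a)| := abs_sub_le _ _ _
      _ ≤ _ := by rw [abs_sub_comm (L f)]; linarith
  choose a ha using fun n : ℕ => hex (1 / (n + 1 : ℝ)) Nat.one_div_pos_of_nat
  have hdist : ∀ m n : ℕ, ‖T (a m) - T (a n)‖ ≤ 1 / (m + 1 : ℝ) + 1 / (n + 1 : ℝ) := by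
    intro m n
    obtain ⟨f, hf1, hf⟩ := exists_dual_vector'' ℝ (T (a m) - T (a n))
    have hm : |L f - f (T (a m))| ≤ 1 / (m + 1 : ℝ) := (ha m f).trans
      (mul_le_of_le_one_left Nat.one_div_pos_of_nat.le hf1)
    have hn : |L f - f (T (a n))| ≤ 1 / (n + 1 : ℝ) := (ha n f).trans
      (mul_le_of_le_one_left Nat.one_div_pos_of_nat.le hf1)
    have hf' : ‖T (a m) - T (a n)‖ = f (T (a m)) - f (T (a n)) := by
      rw [← map_sub f]; exact hf.symm
    rw [hf']
    rw [abs_le] at hm hn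
    linarith [hm.1, hn.2]
  have hCauchy : CauchySeq fun n => T (a n) := by
    rw [Metric.cauchySeq_iff]
    intro ε hε
    obtain ⟨N, hN⟩ := exists_nat_one_div_lt (half_pos hε)
    refine ⟨N, fun m hm n hn => ?_⟩
    rw [dist_eq_norm]
    have h1 : 1 / (m + 1 : ℝ) ≤ 1 / (N + 1 : ℝ) := Nat.one_div_le_one_div hm
    have h2 : 1 / (n + 1 : ℝ) ≤ 1 / (N + 1 : ℝ) := Nat.one_div_le_one_div hn
    linarith [hdist m n]
  obtain ⟨y, hy⟩ := cauchySeq_tendsto_of_complete hCauchy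
  refine ⟨toWeakSpace ℝ Y y, ?_⟩
  rw [← hmap]
  refine tendsto_toWeakSpace_iff.2 fun f => ?_
  have h0 : Tendsto (fun n : ℕ => L f - f (T (a n))) atTop (𝓝 0) := by
    refine squeeze_zero_norm (fun n => ha n f) ?_
    simpa using tendsto_one_div_add_atTop_nhds_zero_nat.const_mul ‖f‖
  have h1 : Tendsto (fun n : ℕ => L f - f (T (a n))) atTop (𝓝 (L f - f y)) :=
    tendsto_const_nhds.sub ((f.continuous.tendsto y).comp hy)
  rw [← sub_eq_zero.1 (tendsto_nhds_unique h1 h0)]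
  exact hL f

end Compactness

/-! ### Rosenthal's disjointification lemma. -/

section Rosenthal

/-- Rosenthal's lemma: a nonnegative matrix with uniformly bounded row sums has an infinite
submatrix whose off-diagonal row sums are small. -/
theorem exists_injective_forall_sum_le {η : ℝ} (hη : 0 ≤ η) (m : ℕ) (a : ℕ → ℕ → ℝ)
    (ha : ∀ n k, 0 ≤ a n k) (hsum : ∀ n, ∀ F : Finset ℕ, ∑ k ∈ F, a n k ≤ m * η) :
    ∃ φ : ℕ → ℕ, Function.Injective φ ∧
      ∀ n, ∀ F : Finset ℕ, n ∉ F → ∑ k ∈ F, a (φ n) (φ k) ≤ η := by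
  classical
  induction m generalizing a with
  | zero =>
    refine ⟨id, Function.injective_id, fun n F _ => (hsum n F).trans ?_⟩
    simpa using hη
  | succ m ih =>
    -- `Nat.pair` splits ℕ into infinitely many infinite blocks. If no block works, each contains a
    -- row with mass above η inside its own block; keeping one such row per block lowers the row
    -- bound by η.
    by_cases hp : ∃ p, ∀ n, ∀ F : Finset ℕ, n ∉ F →
        ∑ k ∈ F, a (Nat.pair p n) (Nat.pair p k) ≤ η
    · obtain ⟨p, hp⟩ := hp
      exact ⟨Nat.pair p, fun i j hij => (Nat.pair_eq_pair.1 hij).2, hp⟩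
    push Not at hp
    choose n F hnF hF using hp
    have hinj : Function.Injective fun p => Nat.pair p (n p) :=
      fun i j hij => (Nat.pair_eq_pair.1 hij).1
    obtain ⟨φ, hφ, hφs⟩ := ih (fun p q => a (Nat.pair p (n p)) (Nat.pair q (n q)))
      (fun p q => ha _ _) (by
        intro p G
        have hdisj : Disjoint (G.image fun q => Nat.pair q (n q)) ((F p).image (Nat.pair p)) := by
          rw [Finset.disjoint_left]
          intro x hx hx'
          obtain ⟨q, -, rfl⟩ := Finset.mem_image.1 hx
          obtain ⟨k, hk, hkq⟩ := Finset.mem_image.1 hx'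
          obtain ⟨rfl, rfl⟩ := Nat.pair_eq_pair.1 hkq
          exact hnF _ hk
        have h1 := hsum (Nat.pair p (n p))
          ((G.image fun q => Nat.pair q (n q)) ∪ (F p).image (Nat.pair p))
        rw [Finset.sum_union hdisj, Finset.sum_image (fun i _ j _ hij => hinj hij),
          Finset.sum_image (fun i _ j _ hij => (Nat.pair_eq_pair.1 hij).2)] at h1
        have h2 := hF p
        push_cast at h1
        linarith)
    exact ⟨fun i => Nat.pair (φ i) (n (φ i)), hinj.comp hφ, hφs⟩

end Rosenthal

/-! ### Order weakly compact operators on disjoint sequences. -/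

section DisjointSequences

variable {E : Type*} [NormedAddCommGroup E] [NormedSpace ℝ E] [Lattice E] [IsOrderedAddMonoid E]
  [IsOrderedModule ℝ E] [HasSolidNorm E]
  {Y : Type*} [NormedAddCommGroup Y] [NormedSpace ℝ Y]

/-- A positive functional controlling the change of `‖T x‖` when `x` is perturbed. -/
lemma ContinuousLinearMap.exists_nonneg_norm_apply_sub_le (T : E →L[ℝ] Y) (x : E) :
    ∃ h : StrongDual ℝ E, (∀ y, 0 ≤ y → 0 ≤ h y) ∧ (∀ y, h y ≤ ‖T‖ * ‖y‖) ∧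
      ∀ y, ‖T x‖ - h |y| ≤ ‖T (x - y)‖ := by
  obtain ⟨f, hf1, hf⟩ := exists_dual_vector'' ℝ (T x)
  obtain ⟨h, h0, hdom, hn⟩ := StrongDual.exists_nonneg_abs_apply_le (f.comp T)
  refine ⟨h, h0, fun y => ?_, fun y => ?_⟩
  · refine (le_abs_self _).trans ((h.le_opNorm y).trans ?_)
    refine mul_le_mul_of_nonneg_right (hn.trans ?_) (norm_nonneg _)
    exact (f.opNorm_comp_le T).trans (mul_le_of_le_one_left (norm_nonneg _) hf1)
  · have h1 : f (T (x - y)) ≤ ‖T (x - y)‖ :=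
      (le_abs_self _).trans ((f.le_opNorm _).trans (mul_le_of_le_one_left (norm_nonneg _) hf1))
    have h2 : f (T y) ≤ h |y| := (le_abs_self _).trans (hdom y)
    have h3 : f (T x) = ‖T x‖ := hf
    rw [map_sub, map_sub] at h1
    rw [map_sub]
    linarith

lemma exists_strictMono_le_norm_of_not_tendsto {Y : Type*} [NormedAddCommGroup Y] {x : ℕ → Y} (hx : ¬ Tendsto x atTop (𝓝 0)) :
    ∃ ε : ℝ, 0 < ε ∧ ∃ φ : ℕ → ℕ, StrictMono φ ∧ ∀ n, ε ≤ ‖x (φ n)‖ := by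
  rw [Metric.tendsto_atTop] at hx
  push Not at hx
  obtain ⟨ε, hε, hx⟩ := hx
  simp only [dist_zero_right] at hx
  obtain ⟨φ, hφ, hφx⟩ := extraction_of_frequently_atTop (frequently_atTop.2 hx)
  exact ⟨ε, hε, φ, hφ, hφx⟩

/-- A weakly clustering sequence is approximated in norm by convex combinations of its tails. -/
lemma exists_mem_convexHull_norm_sub_lt {s : ℕ → Y} {y : Y}
    (hy : MapClusterPt (toWeakSpace ℝ Y y) atTop fun n => toWeakSpace ℝ Y (s n))
    (N : ℕ) {δ : ℝ} (hδ : 0 < δ) : ∃ c ∈ convexHull ℝ (s '' Ici N), ‖c - y‖ < δ := by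
  have h1 : toWeakSpace ℝ Y y ∈ closure (toWeakSpace ℝ Y '' convexHull ℝ (s '' Ici N)) := by
    refine ClusterPt.mem_closure (ClusterPt.mono hy (le_principal_iff.2 ?_))
    refine mem_map.2 (mem_of_superset (Ici_mem_atTop N) fun n hn =>
      mem_image_of_mem _ (subset_convexHull ℝ _ (mem_image_of_mem _ hn)))
  rw [← (convex_convexHull ℝ _).toWeakSpace_closure ℝ] at h1
  have h2 := (toWeakSpace ℝ Y).injective.mem_set_image.1 h1
  obtain ⟨c, hc, hcy⟩ := Metric.mem_closure_iff.1 h2 δ hδ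
  exact ⟨c, hc, by rwa [← dist_eq_norm, dist_comm]⟩

/-- An order weakly compact operator maps order bounded disjoint sequences to norm null sequences. -/
theorem OrderWeaklyCompact.tendsto_of_disjoint {T : E →L[ℝ] Y} (hT : OrderWeaklyCompact T)
    {v : E} (hv : 0 ≤ v) {z : ℕ → E} (hz : ∀ n, z n ∈ Icc 0 v)
    (hd : ∀ i j, i ≠ j → z i ⊓ z j = 0) : Tendsto (fun n => T (z n)) atTop (𝓝 0) := by
  by_contra hcon
  obtain ⟨ε, hε, ψ, hψ, hψz⟩ := exists_strictMono_le_norm_of_not_tendsto hcon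
  choose h₀ h₀pos h₀le h₀T using fun n => T.exists_nonneg_norm_apply_sub_le (z (ψ n))
  obtain ⟨m, hm⟩ := exists_nat_gt ((‖T‖ * ‖v‖) / (ε / 4))
  rw [div_lt_iff₀ (by positivity)] at hm
  obtain ⟨φ, hφ, hφs⟩ := exists_injective_forall_sum_le (η := ε / 4) (by positivity) m
    (fun n k => h₀ n (z (ψ k))) (fun n k => h₀pos n _ (hz _).1) (by
      intro n F
      rw [← map_sum]
      refine le_trans ?_ ((h₀le n v).trans hm.le)
      refine StrongDual.mono_of_nonneg (h₀pos n) (Finset.sum_le_of_disjoint hv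
        (fun i _ => (hz _).1) (fun i _ => (hz _).2) fun i _ j _ hij => hd _ _ fun h => hij (hψ.injective h)))
  let e : ℕ → E := fun n => z (ψ (φ n))
  let h : ℕ → StrongDual ℝ E := fun n => h₀ (φ n)
  have he0 : ∀ n, 0 ≤ e n := fun n => (hz _).1
  have hhs : ∀ n, ∀ F : Finset ℕ, n ∉ F → h n (∑ k ∈ F, e k) ≤ ε / 4 := fun n F hF => by
    rw [map_sum]; exact hφs n F hF
  let σ : ℕ → E := fun n => ∑ k ∈ Finset.range n, e k
  have hσ : ∀ n, σ n ∈ Icc 0 v := fun n => ⟨Finset.sum_nonneg fun k _ => he0 k,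
    Finset.sum_le_of_disjoint hv (fun i _ => he0 i) (fun i _ => (hz _).2)
      fun i _ j _ hij => hd _ _ fun h => hij (hφ (hψ.injective h))⟩
  obtain ⟨y', -, hy'⟩ := (hT v hv).exists_mapClusterPt_of_frequently (l := atTop) (f := fun n => toWeakSpace ℝ Y (T (σ n)))
    (Eventually.frequently (f := atTop) <| Eventually.of_forall fun n => subset_closure (mem_image_of_mem _ (mem_image_of_mem _ (hσ n))))
  obtain ⟨y, rfl⟩ := (toWeakSpace ℝ Y).surjective y'
  have himage : ∀ N, convexHull ℝ ((fun n => T (σ n)) '' Ici N) = T '' convexHull ℝ (σ '' Ici N) := by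
    intro N
    rw [← image_image T σ]
    exact ((T : E →ₗ[ℝ] Y).image_convexHull _).symm
  obtain ⟨c, hc, hcy⟩ := exists_mem_convexHull_norm_sub_lt hy' 0 (by positivity : 0 < ε / 8)
  rw [himage] at hc
  obtain ⟨a, ha, rfl⟩ := hc
  obtain ⟨n, han⟩ : ∃ n, a ∈ convexHull ℝ (σ '' Iic n) := by
    have hdir : Directed (· ⊆ ·) fun n => convexHull ℝ (σ '' Iic n) :=
      Monotone.directed_le fun i j hij => convexHull_mono (image_mono (Iic_subset_Iic.2 hij))
    have hconv : Convex ℝ (⋃ n, convexHull ℝ (σ '' Iic n)) :=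
      hdir.convex_iUnion fun n => convex_convexHull ℝ _
    refine mem_iUnion.1 (convexHull_min ?_ hconv ha)
    rintro _ ⟨n, -, rfl⟩
    exact mem_iUnion.2 ⟨n, subset_convexHull ℝ _ (mem_image_of_mem _ self_mem_Iic)⟩
  -- Here a averages partial sums up to σ n and b averages those from σ (n + 1) on, so b - a is e n
  -- plus terms on which h n is at most ε / 2. Yet T a and T b are both within ε / 8 of y.
  obtain ⟨c', hc', hcy'⟩ := exists_mem_convexHull_norm_sub_lt hy' (n + 1) (by positivity : 0 < ε / 8)
  rw [himage] at hc'
  obtain ⟨b, hb, rfl⟩ := hc'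
  have hσmono : Monotone σ := fun i j hij => Finset.sum_le_sum_of_subset_of_nonneg
    (Finset.range_mono hij) fun k _ _ => he0 k
  have ha' : a ∈ Icc 0 (σ n) := by
    refine convexHull_min ?_ (convex_Icc _ _) han
    rintro _ ⟨k, hk, rfl⟩
    exact ⟨(hσ k).1, hσmono hk⟩
  have hb' : σ (n + 1) ≤ b ∧ h n b ≤ h n (σ (n + 1)) + ε / 4 := by
    have hconv : Convex ℝ (Ici (σ (n + 1)) ∩ {x | h n x ≤ h n (σ (n + 1)) + ε / 4}) :=
      (convex_Ici _).inter ((convex_Iic _).linear_preimage ((h n : E →L[ℝ] ℝ) : E →ₗ[ℝ] ℝ))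
    refine convexHull_min ?_ hconv hb
    rintro _ ⟨k, hk, rfl⟩
    refine ⟨hσmono hk, ?_⟩
    have h1 : σ k = σ (n + 1) + ∑ i ∈ Finset.Ico (n + 1) k, e i :=
      (Finset.sum_range_add_sum_Ico _ hk).symm
    have h2 := hhs n (Finset.Ico (n + 1) k) (by simp)
    rw [mem_ofPred_eq, h1, map_add]
    linarith
  have hsucc : σ (n + 1) = σ n + e n := Finset.sum_range_succ _ _
  have hσn : h n (σ n) ≤ ε / 4 := hhs n (Finset.range n) (by simp)
  have hpos := h₀pos (φ n)
  have h3 := h₀T (φ n) (e n - (b - a))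
  rw [sub_sub_cancel] at h3
  have h4 : ‖T (b - a)‖ < ε / 4 := by
    rw [map_sub, show T b - T a = (T b - y) - (T a - y) by abel]
    exact (norm_sub_le _ _).trans_lt (by linarith)
  have h5 : |e n - (b - a)| ≤ (b - σ (n + 1)) + (σ n - a) := by
    have : e n - (b - a) = -((b - σ (n + 1)) + (σ n - a)) := by rw [hsucc]; abel
    rw [this, abs_neg, abs_of_nonneg]
    exact add_nonneg (sub_nonneg.2 hb'.1) (sub_nonneg.2 ha'.2)
  have h6 := StrongDual.mono_of_nonneg hpos h5
  rw [map_add, map_sub, map_sub] at h6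
  have h7 := hpos a ha'.1
  have h8 : ε ≤ ‖T (e n)‖ := hψz (φ n)
  have h9 : h n = h₀ (φ n) := rfl
  rw [h9] at hb' hσn
  have h10 := hb'.2
  linarith

end DisjointSequences

/-! ### Failure of domination produces disjoint sequences. -/

section DominationUpToEpsilon

variable {E : Type*} [NormedAddCommGroup E] [NormedSpace ℝ E] [Lattice E]
  {Y : Type*} [NormedAddCommGroup Y] [NormedSpace ℝ Y]

/-- On `[0, p]`, no positive functional dominates `‖T ·‖` up to `ε`. -/
def NotDominatedOn (T : E →L[ℝ] Y) (p : E) (ε : ℝ) : Prop :=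
  ∀ g : StrongDual ℝ E, (∀ x, 0 ≤ x → 0 ≤ g x) → ∃ x ∈ Icc 0 p, g x + ε < ‖T x‖

variable [IsOrderedAddMonoid E] [HasSolidNorm E]

lemma norm_apply_le_of_mem_Icc (T : E →L[ℝ] Y) {x p : E} (hx : x ∈ Icc 0 p) :
    ‖T x‖ ≤ ‖T‖ * ‖p‖ :=
  (T.le_opNorm x).trans
    (mul_le_mul_of_nonneg_left (norm_le_norm_of_nonneg_of_le hx.1 hx.2) (norm_nonneg _))

variable [IsOrderedModule ℝ E]

/-- If `‖T ·‖` is not dominated on `[0, p]`, there are elements of `[0, p]` with large images,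
together with functionals witnessing this, each of which almost vanishes on the later elements. -/
lemma NotDominatedOn.exists_seq {T : E →L[ℝ] Y} {p : E} {ε : ℝ} (hT : NotDominatedOn T p ε)
    (hε : 0 < ε) {δ : ℝ} (hδ : 0 < δ) :
    ∃ (x : ℕ → E) (h : ℕ → StrongDual ℝ E), (∀ n, x n ∈ Icc 0 p) ∧
      (∀ n y, 0 ≤ y → 0 ≤ h n y) ∧ (∀ n y, h n y ≤ ‖T‖ * ‖y‖) ∧
      (∀ n y, ε - h n |y| ≤ ‖T (x n - y)‖) ∧ ∀ m n, m < n → h m (x n) ≤ δ := by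
  classical
  set M := ‖T‖ * ‖p‖
  let P : E × StrongDual ℝ E → Prop := fun q => q.1 ∈ Icc 0 p ∧ (∀ y, 0 ≤ y → 0 ≤ q.2 y) ∧
    (∀ y, q.2 y ≤ ‖T‖ * ‖y‖) ∧ ∀ y, ε - q.2 |y| ≤ ‖T (q.1 - y)‖
  obtain ⟨f, hfP, hfr⟩ := exists_seq_of_forall_finset_exists P (fun q q' => q.2 q'.1 ≤ δ) (by
    intro s hs
    have hM0 : 0 ≤ M := mul_nonneg (norm_nonneg _) (norm_nonneg _)
    -- Testing against this functional gives (M / δ) q.2 x ≤ ‖T x‖ ≤ M for each earlier q, that is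
    -- q.2 x ≤ δ.
    have hgpos : ∀ y, 0 ≤ y → 0 ≤ ((M / δ) • ∑ q ∈ s, q.2) y := by
      intro y hy
      rw [smul_apply, sum_apply]
      exact mul_nonneg (div_nonneg hM0 hδ.le) (Finset.sum_nonneg fun q hq => (hs q hq).2.1 y hy)
    obtain ⟨x, hx, hxT⟩ := hT _ hgpos
    obtain ⟨h, hpos, hle, hT'⟩ := T.exists_nonneg_norm_apply_sub_le x
    have hxM : ‖T x‖ ≤ M := norm_apply_le_of_mem_Icc T hx
    have hgx := hgpos x hx.1
    have hMpos : 0 < M := by linarith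
    refine ⟨(x, h), ⟨hx, hpos, hle, fun y => ?_⟩, fun q hq => ?_⟩
    · have := hT' y
      dsimp only
      linarith
    · have h1 : q.2 x ≤ ∑ q ∈ s, q.2 x :=
        Finset.single_le_sum (f := fun q : E × StrongDual ℝ E => q.2 x)
          (fun q hq => (hs q hq).2.1 x hx.1) hq
      rw [smul_apply, sum_apply, smul_eq_mul] at hxT
      have h2 : M / δ * q.2 x ≤ M / δ * ∑ q ∈ s, q.2 x :=
        mul_le_mul_of_nonneg_left h1 (div_nonneg hM0 hδ.le)
      have h3 : M / δ * q.2 x ≤ M := by linarith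
      rw [div_mul_eq_mul_div, div_le_iff₀ hδ] at h3
      exact le_of_mul_le_mul_left h3 hMpos)
  exact ⟨fun n => (f n).1, fun n => (f n).2, fun n => (hfP n).1, fun n => (hfP n).2.1,
    fun n => (hfP n).2.2.1, fun n => (hfP n).2.2.2, hfr⟩

/-- From x i, subtract K times each later element, where h i is tiny, and K⁻¹ times each earlier
one, where the bound M suffices. The reciprocal coefficients make the positive parts disjoint. The
constants depend on N, so this gives only finite families. -/
lemma NotDominatedOn.exists_disjoint_fin {T : E →L[ℝ] Y} {p : E} {ε ε' : ℝ}
    (hT : NotDominatedOn T p ε) (hε : 0 < ε) (hε' : ε' < ε) (N : ℕ) :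
    ∃ z : Fin N → E, (∀ i, z i ∈ Icc 0 p) ∧ (∀ i j, i ≠ j → z i ⊓ z j = 0) ∧
      ∀ i, ε' ≤ ‖T (z i)‖ := by
  set M := ‖T‖ * ‖p‖
  have hM0 : 0 ≤ M := mul_nonneg (norm_nonneg _) (norm_nonneg _)
  set τ := (ε - ε') / (N + 1) with hτdef
  have hτ : 0 < τ := div_pos (sub_pos.2 hε') (by positivity)
  set K := (M + 1) / τ with hKdef
  have hK : 0 < K := by positivity
  have hKM : K⁻¹ * M ≤ τ := by
    rw [hKdef, inv_div, div_mul_eq_mul_div, div_le_iff₀ (by positivity)]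
    exact mul_le_mul_of_nonneg_left (by linarith) hτ.le
  obtain ⟨x, h, hx, hpos, hle, hhT, hδ⟩ := hT.exists_seq hε (div_pos hτ hK)
  let c : ℕ → ℕ → ℝ := fun i j => if i < j then K else K⁻¹
  have hc : ∀ i j, 0 < c i j := fun i j => by
    simp only [c]; split_ifs <;> positivity
  have hch : ∀ i j, i ≠ j → c i j * h i (x j) ≤ τ := by
    intro i j hij
    simp only [c]
    split_ifs with hlt
    · calc K * h i (x j) ≤ K * (τ / K) := mul_le_mul_of_nonneg_left (hδ i j hlt) hK.le
        _ = τ := mul_div_cancel₀ _ hK.ne'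
    · refine (mul_le_mul_of_nonneg_left ((hle i (x j)).trans ?_) (inv_pos.2 hK).le).trans hKM
      exact mul_le_mul_of_nonneg_left (norm_le_norm_of_nonneg_of_le (hx j).1 (hx j).2)
        (norm_nonneg _)
  let y : ℕ → E := fun i => ∑ j ∈ (Finset.range N).erase i, c i j • x j
  have hcx : ∀ i j, 0 ≤ c i j • x j := fun i j => smul_nonneg (hc i j).le (hx j).1
  have hy0 : ∀ i, 0 ≤ y i := fun i => Finset.sum_nonneg fun j _ => hcx i j
  have hhy : ∀ i, h i (y i) ≤ ε - ε' := by
    intro i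
    calc h i (y i) = ∑ j ∈ (Finset.range N).erase i, c i j * h i (x j) := by
          simp only [y, map_sum, map_smul, smul_eq_mul]
      _ ≤ ∑ j ∈ (Finset.range N).erase i, τ :=
          Finset.sum_le_sum fun j hj => hch i j (Finset.ne_of_mem_erase hj).symm
      _ = ((Finset.range N).erase i).card * τ := by rw [Finset.sum_const, nsmul_eq_mul]
      _ ≤ (N + 1) * τ := by
          refine mul_le_mul_of_nonneg_right ?_ hτ.le
          have := Finset.card_le_card (Finset.erase_subset i (Finset.range N))
          rw [Finset.card_range] at this
          have : (((Finset.range N).erase i).card : ℝ) ≤ N := by exact_mod_cast this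
          linarith
      _ = ε - ε' := by rw [hτdef]; field_simp
  have hzle : ∀ i j, j < N → i ≠ j → (x i - y i)⁺ ≤ (x i - c i j • x j)⁺ := by
    intro i j hj hij
    refine posPart_mono (sub_le_sub_left ?_ _)
    exact Finset.single_le_sum (f := fun j => c i j • x j) (fun k _ => hcx i k)
      (Finset.mem_erase.2 ⟨hij.symm, Finset.mem_range.2 hj⟩)
  have hdisj : ∀ i j, i < N → j < N → i < j → (x i - y i)⁺ ⊓ (x j - y j)⁺ = 0 := by
    intro i j hi hj hij
    have h1 := hzle i j hj hij.ne
    have h2 := hzle j i hi hij.ne'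
    simp only [c, if_pos hij, if_neg hij.not_gt] at h1 h2
    exact inf_eq_zero_of_le_of_le (posPart_sub_smul_inf_posPart_sub_smul hK (x i) (x j))
      (posPart_nonneg _) (posPart_nonneg _) h1 h2
  refine ⟨fun i => (x i - y i)⁺, fun i => ⟨posPart_nonneg _, ?_⟩, fun i j hij => ?_, fun i => ?_⟩
  · exact sup_le ((sub_le_self _ (hy0 i)).trans (hx i).2) ((hx i).1.trans (hx i).2)
  · rcases lt_or_gt_of_ne (Fin.val_ne_of_ne hij) with hlt | hlt
    · exact hdisj i j i.2 j.2 hlt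
    · rw [inf_comm]; exact hdisj j i j.2 i.2 hlt
  · have h1 := hhT i (x i ⊓ y i)
    have h2 : x i - x i ⊓ y i = (x i - y i)⁺ := by rw [← sub_posPart_sub, sub_sub_cancel]
    rw [h2, abs_of_nonneg (le_inf (hx i).1 (hy0 i))] at h1
    have h3 := StrongDual.mono_of_nonneg (hpos i) (inf_le_right : x i ⊓ y i ≤ y i)
    linarith [hhy i]

/-- Pigeonhole: among N > M / η disjoint elements, one overlaps a given x so little that removing it
costs at most η. If functionals dominated on every remainder, their sum would therefore dominate on
[0, p]. -/
lemma NotDominatedOn.exists_disjoint_remainder {T : E →L[ℝ] Y} {p : E} (hp : 0 ≤ p) {ε ε' η : ℝ}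
    (hT : NotDominatedOn T p ε) (hε : 0 < ε) (hε' : ε' < ε) (hη : 0 < η) :
    ∃ z ∈ Icc 0 p, ∃ r ∈ Icc 0 p, z ⊓ r = 0 ∧ ε' ≤ ‖T z‖ ∧ NotDominatedOn T r (ε - η) := by
  set M := ‖T‖ * ‖p‖
  have hM0 : 0 ≤ M := mul_nonneg (norm_nonneg _) (norm_nonneg _)
  obtain ⟨N, hN⟩ := exists_nat_gt (M / η)
  have hN0 : (0 : ℝ) < N := (div_nonneg hM0 hη.le).trans_lt hN
  rw [div_lt_iff₀ hη] at hN
  set θ := (ε - ε') / 2 with hθdef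
  have hθ : 0 < θ := half_pos (sub_pos.2 hε')
  obtain ⟨z, hz, hzd, hzT⟩ := hT.exists_disjoint_fin hε (by linarith : ε' + θ < ε) N
  set C := (M + 1) / θ with hCdef
  have hC : 0 < C := by positivity
  have hCM : C⁻¹ * M ≤ θ := by
    rw [hCdef, inv_div, div_mul_eq_mul_div, div_le_iff₀ (by positivity)]
    exact mul_le_mul_of_nonneg_left (by linarith) hθ.le
  have hsmul0 : ∀ i, 0 ≤ C • z i := fun i => smul_nonneg hC.le (hz i).1
  have hex : ∃ i, NotDominatedOn T (p - C • z i)⁺ (ε - η) := by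
    by_contra! hcon
    unfold NotDominatedOn at hcon
    push Not at hcon
    choose g hgpos hg using hcon
    obtain ⟨x, hx, hxT⟩ := hT (∑ i, g i) (by
      intro y hy
      rw [sum_apply]
      exact Finset.sum_nonneg fun i _ => hgpos i y hy)
    rw [sum_apply] at hxT
    obtain ⟨h, hpos, hle, hhT⟩ := T.exists_nonneg_norm_apply_sub_le x
    have hsum : ∑ i, h (x ⊓ C • z i) ≤ ∑ i : Fin N, M / N := by
      rw [← map_sum, Finset.sum_const, Finset.card_univ, Fintype.card_fin, nsmul_eq_mul,
        mul_div_cancel₀ _ hN0.ne']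
      refine (StrongDual.mono_of_nonneg hpos ((Finset.sum_le_of_disjoint hx.1
        (fun i _ => le_inf hx.1 (hsmul0 i)) (fun i _ => inf_le_left) ?_).trans hx.2)).trans (hle p)
      intro i _ j _ hij
      have h0 : C • z i ⊓ C • z j = 0 := by
        rw [← smul_inf_of_pos hC, hzd i j hij, smul_zero]
      exact inf_eq_zero_of_le_of_le h0 (le_inf hx.1 (hsmul0 i)) (le_inf hx.1 (hsmul0 j))
        inf_le_right inf_le_right
    have : Nonempty (Fin N) := ⟨⟨0, by exact_mod_cast hN0⟩⟩
    obtain ⟨i, -, hi⟩ := Finset.exists_le_of_sum_le Finset.univ_nonempty hsum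
    have h1 := hhT (x ⊓ C • z i)
    have h2 : x - x ⊓ C • z i = (x - C • z i)⁺ := by rw [← sub_posPart_sub, sub_sub_cancel]
    rw [abs_of_nonneg (le_inf hx.1 (hsmul0 i)), h2] at h1
    have h3 := hg i (x - C • z i)⁺ ⟨posPart_nonneg _, posPart_mono (sub_le_sub_right hx.2 _)⟩
    have h4 : g i (x - C • z i)⁺ ≤ g i x :=
      StrongDual.mono_of_nonneg (hgpos i) (sup_le (sub_le_self _ (hsmul0 i)) hx.1)
    have h5 : g i x ≤ ∑ i, g i x :=
      Finset.single_le_sum (f := fun i => g i x) (fun j _ => hgpos j x hx.1) (Finset.mem_univ i)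
    have h6 : M / N ≤ η := by
      rw [div_le_iff₀ hN0]; linarith
    linarith
  obtain ⟨i, hi⟩ := hex
  have hCp : 0 ≤ C⁻¹ • p := smul_nonneg (inv_pos.2 hC).le hp
  refine ⟨(z i - C⁻¹ • p)⁺, ⟨posPart_nonneg _, sup_le ((sub_le_self _ hCp).trans (hz i).2) hp⟩,
    (p - C • z i)⁺, ⟨posPart_nonneg _, sup_le (sub_le_self _ (hsmul0 i)) hp⟩, ?_, ?_, hi⟩
  · have := posPart_sub_smul_inf_posPart_sub_smul (inv_pos.2 hC) (z i) p
    rwa [inv_inv] at this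
  · have h1 : z i ⊓ C⁻¹ • p ∈ Icc 0 (C⁻¹ • p) := ⟨le_inf (hz i).1 hCp, inf_le_right⟩
    have h2 := norm_apply_le_of_mem_Icc T h1
    rw [norm_smul, Real.norm_of_nonneg (inv_pos.2 hC).le] at h2
    have h3 : (z i - C⁻¹ • p)⁺ = z i - z i ⊓ C⁻¹ • p := by rw [← sub_posPart_sub, sub_sub_cancel]
    have h4 := norm_sub_norm_le (T (z i)) (T (z i ⊓ C⁻¹ • p))
    rw [← map_sub, ← h3] at h4
    have h5 : ‖T‖ * (C⁻¹ * ‖p‖) = C⁻¹ * M := by ring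
    linarith [hzT i]

lemma NotDominatedOn.exists_disjoint_seq {T : E →L[ℝ] Y} {p : E} (hp : 0 ≤ p) {ε : ℝ}
    (hT : NotDominatedOn T p ε) (hε : 0 < ε) :
    ∃ z : ℕ → E, (∀ n, z n ∈ Icc 0 p) ∧ (∀ i j, i ≠ j → z i ⊓ z j = 0) ∧
      ∀ n, ε / 2 ≤ ‖T (z n)‖ := by
  -- Each step spends half of the current margin above ε / 2, so the iteration never stops.
  let Q : E → Prop := fun r => r ∈ Icc 0 p ∧ ∃ ε', ε / 2 < ε' ∧ NotDominatedOn T r ε'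
  have hstep : ∀ r : {r // Q r}, ∃ (z : E) (s : {s // Q s}), z ∈ Icc 0 r.1 ∧ s.1 ≤ r.1 ∧
      z ⊓ s.1 = 0 ∧ ε / 2 ≤ ‖T z‖ := by
    rintro ⟨r, hr, ε', hε', hrT⟩
    obtain ⟨z, hz, s, hs, hzs, hzT, hsT⟩ := hrT.exists_disjoint_remainder hr.1
      (by linarith) hε' (half_pos (sub_pos.2 hε'))
    exact ⟨z, ⟨s, ⟨hs.1, hs.2.trans hr.2⟩, _, by linarith, hsT⟩, hz, hs.2, hzs, hzT⟩
  choose Z S hZ hS hZS hZT using hstep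
  let r : ℕ → {r // Q r} := fun n =>
    Nat.rec ⟨p, ⟨hp, le_rfl⟩, ε, half_lt_self hε, hT⟩ (fun _ r => S r) n
  have hr : Antitone fun n => (r n).1 := antitone_nat_of_succ_le fun n => hS (r n)
  have hdisj : ∀ i j, i < j → Z (r i) ⊓ Z (r j) = 0 := fun i j hij =>
    inf_eq_zero_of_le_of_le (hZS (r i)) (hZ _).1 (hZ _).1 le_rfl
      ((hZ (r j)).2.trans (hr (Nat.succ_le_of_lt hij)))
  refine ⟨fun n => Z (r n), fun n => ⟨(hZ _).1, (hZ _).2.trans (r n).2.1.2⟩, fun i j hij => ?_,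
    fun n => hZT _⟩
  rcases lt_or_gt_of_ne hij with hlt | hlt
  · exact hdisj i j hlt
  · rw [inf_comm]; exact hdisj j i hlt

/-- If `T` maps order bounded disjoint sequences to norm null sequences, then `‖T ·‖` is dominated
on order intervals, up to `ε`, by positive functionals. -/
theorem exists_nonneg_norm_apply_le_of_tendsto_of_disjoint {T : E →L[ℝ] Y}
    (hT : ∀ v : E, 0 ≤ v → ∀ z : ℕ → E, (∀ n, z n ∈ Icc 0 v) →
      (∀ i j, i ≠ j → z i ⊓ z j = 0) → Tendsto (fun n => T (z n)) atTop (𝓝 0))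
    {ε : ℝ} (hε : 0 < ε) {v : E} (hv : 0 ≤ v) :
    ∃ g : StrongDual ℝ E, (∀ x, 0 ≤ x → 0 ≤ g x) ∧ ∀ x ∈ Icc (-v) v, ‖T x‖ ≤ g |x| + ε := by
  have h : ¬ NotDominatedOn T v (ε / 2) := by
    intro hcon
    obtain ⟨z, hz, hzd, hzT⟩ := hcon.exists_disjoint_seq hv (half_pos hε)
    have h1 := (hT v hv z hz hzd).norm
    rw [norm_zero] at h1
    have := ge_of_tendsto' h1 hzT
    linarith
  unfold NotDominatedOn at h
  push Not at h
  obtain ⟨g, hg, hgT⟩ := h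
  refine ⟨g, hg, fun x hx => ?_⟩
  have h1 := hgT x⁺ ⟨posPart_nonneg _, sup_le hx.2 hv⟩
  have h2 := hgT x⁻ ⟨negPart_nonneg _, sup_le (neg_le.1 hx.1) hv⟩
  have h3 := norm_sub_le (T x⁺) (T x⁻)
  rw [← map_sub, posPart_sub_negPart] at h3
  rw [← posPart_add_negPart x, map_add]
  linarith

end DominationUpToEpsilon

/-! ### Truncation at a positive element. -/

section Truncation

variable {E : Type*} [AddCommGroup E] [Lattice E] [IsOrderedAddMonoid E]

lemma abs_truncate_le {x c : E} (hc : 0 ≤ c) : |x ⊓ c ⊔ -c| ≤ c :=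
  abs_le'.2 ⟨sup_le inf_le_right (neg_le_self hc), neg_le.1 le_sup_right⟩

lemma abs_truncate_le_abs {x c : E} (hc : 0 ≤ c) : |x ⊓ c ⊔ -c| ≤ |x| :=
  abs_le'.2 ⟨sup_le (inf_le_left.trans (le_abs_self x))
      ((neg_nonpos.2 hc).trans (abs_nonneg x)),
    neg_le.1 ((le_inf (neg_le.1 (neg_le_abs x))
      ((neg_nonpos.2 (abs_nonneg x)).trans hc)).trans le_sup_left)⟩

lemma abs_sub_truncate_le {x c : E} : |x - (x ⊓ c ⊔ -c)| ≤ (|x| - c)⁺ := by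
  refine abs_le'.2 ⟨?_, ?_⟩
  · calc x - (x ⊓ c ⊔ -c) ≤ x - x ⊓ c := sub_le_sub_left le_sup_left _
      _ = (x - c)⁺ := by rw [← sub_posPart_sub, sub_sub_cancel]
      _ ≤ _ := posPart_mono (sub_le_sub_right (le_abs_self x) _)
  · rw [neg_sub, sup_sub]
    refine sup_le ((sub_nonpos.2 inf_le_left).trans (posPart_nonneg _)) ?_
    rw [show -c - x = -x - c by abel]
    exact (sub_le_sub_right (neg_le_abs x) _).trans (le_posPart _)

end Truncation

/-! ### uaw-null families. -/

section UawConvergence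

variable {E : Type u} [NormedAddCommGroup E] [NormedSpace ℝ E] [Lattice E]

lemma tendsto_toWeakSpace_zero_iff {Y : Type*} [NormedAddCommGroup Y] [NormedSpace ℝ Y] {α : Type*}
    {l : Filter α} {x : α → Y} :
    Tendsto (fun a => toWeakSpace ℝ Y (x a)) l (𝓝 0) ↔
      ∀ f : StrongDual ℝ Y, Tendsto (fun a => f (x a)) l (𝓝 0) := by
  have := tendsto_toWeakSpace_iff (l := l) (x := x) (y := (0 : Y))
  simpa only [map_zero] using this

lemma UawTendsto.comp {ι κ : Type*} {x : ι → E} {l : Filter ι} {a : E} (h : UawTendsto x l a)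
    {l' : Filter κ} {φ : κ → ι} (hφ : Tendsto φ l' l) : UawTendsto (x ∘ φ) l' a :=
  fun u hu => (h u hu).comp hφ

lemma uawTendsto_zero_iff {ι : Type*} {x : ι → E} {l : Filter ι} :
    UawTendsto x l 0 ↔ ∀ u : E, 0 ≤ u → ∀ f : StrongDual ℝ E,
      Tendsto (fun i => f (|x i| ⊓ u)) l (𝓝 0) := by
  simp only [UawTendsto, sub_zero, tendsto_toWeakSpace_zero_iff]

lemma UawTendsto.sub_const {ι : Type*} {x : ι → E} {l : Filter ι} {a : E}
    (h : UawTendsto x l a) : UawTendsto (fun i => x i - a) l 0 := by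
  intro u hu
  simpa only [sub_zero] using h u hu

variable [IsOrderedAddMonoid E]

lemma uawTendsto_const {ι : Type*} {l : Filter ι} {x : ι → E} {a : E} (h : ∀ i, x i = a) :
    UawTendsto x l a := by
  intro u hu
  simp only [h, sub_self, abs_zero, inf_eq_left.2 hu, map_zero]
  exact tendsto_const_nhds

/-- A net here either takes some value frequently, giving a constant subnet, or eventually avoids
any finitely many terms and then is itself uaw-null. -/
lemma uawCompact_insert_zero_range {x : ℕ → E} (hx : UawTendsto x atTop 0) :
    UawCompact (insert 0 (range x)) := by
  intro ι _ _ _ y hy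
  by_cases hfreq : ∃ a ∈ insert 0 (range x), ∃ᶠ i in atTop, y i = a
  · obtain ⟨a, ha, hfa⟩ := hfreq
    rw [frequently_atTop] at hfa
    refine ⟨a, ha, {i // y i = a}, inferInstance, ⟨?_⟩, ?_, Subtype.val, ?_,
      uawTendsto_const fun k => k.2⟩
    · rintro ⟨i, hi⟩ ⟨j, hj⟩
      obtain ⟨k, hik, hjk⟩ := exists_ge_ge i j
      obtain ⟨k', hkk', hk'⟩ := hfa k
      exact ⟨⟨k', hk'⟩, hik.trans hkk', hjk.trans hkk'⟩
    · obtain ⟨i⟩ := ‹Nonempty ι›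
      obtain ⟨k, -, hk⟩ := hfa i
      exact ⟨⟨k, hk⟩⟩
    · refine tendsto_atTop.2 fun i => ?_
      obtain ⟨k, hik, hk⟩ := hfa i
      exact mem_of_superset (Ici_mem_atTop (⟨k, hk⟩ : {i // y i = a})) fun k' hk' => hik.trans hk'
  · push Not at hfreq
    refine ⟨0, mem_insert _ _, ι, inferInstance, inferInstance, inferInstance, id, tendsto_id, ?_⟩
    intro u hu
    have hxu := hx u hu
    rw [Function.comp_id]
    intro V hV
    obtain ⟨N, hN⟩ := mem_atTop_sets.1 (hxu hV)
    have hev : ∀ᶠ i in atTop, ∀ n ∈ Finset.range N, y i ≠ x n :=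
      (Finset.eventually_all _).2 fun n _ =>
        hfreq (x n) (mem_insert_of_mem _ (mem_range_self n))
    refine mem_map.2 (mem_of_superset hev fun i hi => ?_)
    rcases hy i with h0 | ⟨n, hn⟩
    · rw [mem_preimage, h0, sub_zero, abs_zero, inf_eq_left.2 hu, map_zero]
      exact mem_of_mem_nhds hV
    · rw [mem_preimage, ← hn]
      refine hN n (not_lt.1 fun hlt => hi n (Finset.mem_range.2 hlt) hn.symm)

variable [IsOrderedModule ℝ E] [HasSolidNorm E]

lemma tendsto_apply_zero_of_abs_le {ι : Type*} {l : Filter ι} {a b : ι → E}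
    (hb : ∀ f : StrongDual ℝ E, Tendsto (fun i => f (b i)) l (𝓝 0)) (hab : ∀ i, |a i| ≤ b i)
    (f : StrongDual ℝ E) : Tendsto (fun i => f (a i)) l (𝓝 0) := by
  obtain ⟨g, hg, hgf, -⟩ := StrongDual.exists_nonneg_abs_apply_le f
  exact squeeze_zero_norm (fun i => (hgf (a i)).trans (StrongDual.mono_of_nonneg hg (hab i))) (hb g)

lemma UawTendsto.of_abs_le {ι : Type*} {l : Filter ι} {x y : ι → E} (hy : UawTendsto y l 0)
    (hxy : ∀ i, |x i| ≤ |y i|) : UawTendsto x l 0 := by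
  rw [uawTendsto_zero_iff] at hy ⊢
  intro u hu f
  refine tendsto_apply_zero_of_abs_le (hy u hu) (fun i => ?_) f
  rw [abs_of_nonneg (le_inf (abs_nonneg _) hu)]
  exact inf_le_inf_right _ (hxy i)

lemma UawTendsto.tendsto_apply_of_mem_Icc {ι : Type*} {l : Filter ι} {x : ι → E}
    (hx : UawTendsto x l 0) {v : E} (hv : 0 ≤ v) (hxv : ∀ i, x i ∈ Icc (-v) v)
    (f : StrongDual ℝ E) : Tendsto (fun i => f (x i)) l (𝓝 0) := by
  refine tendsto_apply_zero_of_abs_le (uawTendsto_zero_iff.1 hx v hv) (fun i => ?_) f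
  exact le_inf le_rfl (abs_le'.2 ⟨(hxv i).2, neg_le.1 (hxv i).1⟩)

/-- Disjoint sequences of positive elements are uaw-null. -/
lemma uawTendsto_zero_of_disjoint {z : ℕ → E} (hz : ∀ n, 0 ≤ z n)
    (hd : ∀ i j, i ≠ j → z i ⊓ z j = 0) : UawTendsto z atTop 0 := by
  rw [uawTendsto_zero_iff]
  intro u hu f
  obtain ⟨g, hg, hgf, -⟩ := StrongDual.exists_nonneg_abs_apply_le f
  have h0 : ∀ n, 0 ≤ |z n| ⊓ u := fun n => le_inf (abs_nonneg _) hu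
  have hsum : Summable fun n => g (|z n| ⊓ u) := by
    refine summable_of_sum_le (c := g u) (fun n => hg _ (h0 n)) fun F => ?_
    rw [← map_sum]
    refine StrongDual.mono_of_nonneg hg (Finset.sum_le_of_disjoint hu (fun i _ => h0 i)
      (fun i _ => inf_le_right) fun i _ j _ hij => ?_)
    refine inf_eq_zero_of_le_of_le (hd i j hij) (h0 i) (h0 j) ?_ ?_
    · exact inf_le_left.trans (abs_of_nonneg (hz i)).le
    · exact inf_le_left.trans (abs_of_nonneg (hz j)).le
  refine squeeze_zero_norm (fun n => ?_) hsum.tendsto_atTop_zero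
  have := hgf (|z n| ⊓ u)
  rwa [abs_of_nonneg (h0 n)] at this

end UawConvergence

/-! ### Consequences for operators. -/

section Operators

variable {E : Type u} [NormedAddCommGroup E] [NormedSpace ℝ E] [Lattice E]
  {Y : Type*} [NormedAddCommGroup Y] [NormedSpace ℝ Y] {T : E →L[ℝ] Y}

lemma tendsto_apply_of_uawTendsto_zero {v : E}
    (hT : ∀ ε : ℝ, 0 < ε → ∃ g : StrongDual ℝ E, (∀ x : E, 0 ≤ x → 0 ≤ g x) ∧ ∃ u : E, 0 ≤ u ∧
      ∀ x ∈ Icc (-v) v, ‖T x‖ ≤ g (|x| ⊓ u) + ε)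
    {ι : Type*} {l : Filter ι} {x : ι → E} (hxv : ∀ i, x i ∈ Icc (-v) v)
    (hx : UawTendsto x l 0) : Tendsto (fun i => T (x i)) l (𝓝 0) := by
  rw [Metric.tendsto_nhds]
  intro ε hε
  obtain ⟨g, -, u, hu, hgu⟩ := hT (ε / 2) (half_pos hε)
  have h1 := (uawTendsto_zero_iff.1 hx u hu g).eventually_lt_const (half_pos hε)
  filter_upwards [h1] with i hi
  rw [dist_zero_right]
  linarith [hgu (x i) (hxv i)]

variable [IsOrderedAddMonoid E]

/-- The subnet makes T a a cluster point of the sequence T (x n), and in a metric space a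
subsequence then suffices. -/
lemma exists_strictMono_tendsto_of_hasSubnetUawTendsto
    (hT : ∀ ε : ℝ, 0 < ε → ∀ v : E, 0 ≤ v →
      ∃ g : StrongDual ℝ E, (∀ x : E, 0 ≤ x → 0 ≤ g x) ∧ ∃ u : E, 0 ≤ u ∧
        ∀ x ∈ Icc (-v) v, ‖T x‖ ≤ g (|x| ⊓ u) + ε)
    {A : Set E} (hA : OrderBounded A) {x : ℕ → E} (hx : ∀ n, x n ∈ A) {a : E}
    (hxa : HasSubnetUawTendsto (fun n : ULift.{u} ℕ => x n.down) a) :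
    ∃ φ : ℕ → ℕ, StrictMono φ ∧ Tendsto (fun n => T (x (φ n))) atTop (𝓝 (T a)) := by
  obtain ⟨b, c, hbc⟩ := hA
  obtain ⟨κ, _, _, _, φ, hφ, hφa⟩ := hxa
  let v := |b| + |c| + |a|
  have hv : 0 ≤ v := add_nonneg (add_nonneg (abs_nonneg _) (abs_nonneg _)) (abs_nonneg _)
  have hmem : ∀ k, x (φ k).down - a ∈ Icc (-v) v := by
    intro k
    obtain ⟨h1, h2⟩ := hbc (hx (φ k).down)
    constructor
    · rw [neg_le, neg_sub]
      calc a - x (φ k).down ≤ |a| + |b| := by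
            rw [sub_eq_add_neg]
            exact add_le_add (le_abs_self a) ((neg_le_neg h1).trans (neg_le_abs b))
        _ ≤ |a| + |b| + |c| := le_add_of_nonneg_right (abs_nonneg c)
        _ = v := by simp only [v]; abel
    · calc x (φ k).down - a ≤ |c| + |a| := by
            rw [sub_eq_add_neg]
            exact add_le_add (h2.trans (le_abs_self c)) (neg_le_abs a)
        _ ≤ |b| + (|c| + |a|) := le_add_of_nonneg_left (abs_nonneg b)
        _ = v := by simp only [v]; abel
  have h1 := tendsto_apply_of_uawTendsto_zero (fun ε hε => hT ε hε v hv) hmem hφa.sub_const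
  have h2 : Tendsto (fun k => T (x (φ k).down)) atTop (𝓝 (T a)) := by
    rw [← tendsto_sub_nhds_zero_iff]
    simpa only [map_sub] using h1
  have hdown : Tendsto (fun k => (φ k).down) atTop atTop :=
    tendsto_atTop.2 fun n => (tendsto_atTop.1 hφ ⟨n⟩).mono fun k hk => hk
  exact MapClusterPt.tendsto_subseq
    (MapClusterPt.of_comp hdown (u := fun n => T (x n)) h2.mapClusterPt)

lemma isCompact_closure_of_forall_seq {X : Type*} [PseudoMetricSpace X] {s : Set X}
    (h : ∀ x : ℕ → X, (∀ n, x n ∈ s) → ∃ (a : X) (φ : ℕ → ℕ), StrictMono φ ∧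
      Tendsto (x ∘ φ) atTop (𝓝 a)) : IsCompact (closure s) := by
  refine IsSeqCompact.isCompact fun y hy => ?_
  have hex : ∀ n : ℕ, ∃ z ∈ s, dist (y n) z < 1 / (n + 1 : ℝ) := fun n =>
    Metric.mem_closure_iff.1 (hy n) _ Nat.one_div_pos_of_nat
  choose z hz hyz using hex
  obtain ⟨a, φ, hφ, hφa⟩ := h z hz
  have h0 : Tendsto (fun n => dist (z (φ n)) (y (φ n))) atTop (𝓝 0) := by
    refine squeeze_zero (fun n => dist_nonneg) (fun n => ?_)
      (tendsto_one_div_add_atTop_nhds_zero_nat.comp hφ.tendsto_atTop)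
    rw [dist_comm]
    exact (hyz _).le
  have hya : Tendsto (y ∘ φ) atTop (𝓝 a) := (tendsto_iff_of_dist h0).1 hφa
  exact ⟨a, isClosed_closure.mem_of_tendsto hya (Eventually.of_forall fun n => hy _), φ, hφ, hya⟩

variable [IsOrderedModule ℝ E] [HasSolidNorm E]

/-- Compactness supplies a norm limit along a subsequence; it must be 0, because order bounded
uaw-null sequences are weakly null. -/
lemma tendsto_apply_of_forall_isCompact_closure_image
    (hT : ∀ A : Set E, OrderBounded A → UawCompact A → IsCompact (closure (T '' A)))
    {v : E} (hv : 0 ≤ v) {x : ℕ → E} (hxv : ∀ n, x n ∈ Icc (-v) v) (hx : UawTendsto x atTop 0) :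
    Tendsto (fun n => T (x n)) atTop (𝓝 0) := by
  by_contra hcon
  obtain ⟨ε, hε, φ, hφ, hφx⟩ := exists_strictMono_le_norm_of_not_tendsto hcon
  have hxφ := hx.comp hφ.tendsto_atTop
  have hbdd : OrderBounded (insert 0 (range (x ∘ φ))) := by
    refine ⟨-v, v, insert_subset ⟨neg_nonpos.2 hv, hv⟩ ?_⟩
    rintro _ ⟨n, rfl⟩
    exact hxv _
  obtain ⟨y, -, ψ, hψ, hψy⟩ := (hT _ hbdd (uawCompact_insert_zero_range hxφ)).tendsto_subseq
    (x := fun n => T (x (φ n)))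
    fun n => subset_closure (mem_image_of_mem _ (mem_insert_of_mem _ (mem_range_self n)))
  have hy : y = 0 := by
    refine (SeparatingDual.eq_iff_forall_dual_eq (R := ℝ)).2 fun f => ?_
    rw [map_zero]
    refine tendsto_nhds_unique ((f.continuous.tendsto y).comp hψy) ?_
    exact (hxφ.comp hψ.tendsto_atTop).tendsto_apply_of_mem_Icc hv (fun n => hxv _) (f.comp T)
  have := ge_of_tendsto' hψy.norm fun n => hφx (ψ n)
  rw [hy, norm_zero] at this
  linarith

/-- Along a subsequence the majorants y n converge to some a. Truncating at |a| leaves a part in the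
solid hull of {|a|} and an error of norm at most ‖y n - a‖. -/
lemma sLWeaklyCompact_of_isCompact_closure (hT : ∀ v : E, 0 ≤ v → SLWeaklyCompact {v} T)
    {S : Set E} (hS : IsCompact (closure S)) : SLWeaklyCompact S T := by
  intro x hxS hx
  by_contra hcon
  obtain ⟨ε, hε, φ, hφ, hφx⟩ := exists_strictMono_le_norm_of_not_tendsto hcon
  choose y hyS hxy using hxS
  obtain ⟨a, -, ψ, hψ, hψa⟩ := hS.tendsto_subseq (x := y ∘ φ) fun n => subset_closure (hyS _)
  let x₁ : ℕ → E := fun n => x (φ (ψ n))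
  let x₂ : ℕ → E := fun n => x₁ n ⊓ |a| ⊔ -|a|
  have hx₁ : UawTendsto x₁ atTop 0 := hx.comp (hφ.comp hψ).tendsto_atTop
  have h2 : Tendsto (fun n => T (x₂ n)) atTop (𝓝 0) :=
    hT |a| (abs_nonneg a) x₂
      (fun n => ⟨|a|, rfl, (abs_truncate_le (abs_nonneg a)).trans (abs_abs a).ge⟩)
      (hx₁.of_abs_le fun n => abs_truncate_le_abs (abs_nonneg a))
  have hsub : Tendsto (fun n => x₁ n - x₂ n) atTop (𝓝 0) := by
    have h0 : Tendsto (fun n => ‖y (φ (ψ n)) - a‖) atTop (𝓝 0) :=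
      tendsto_iff_norm_sub_tendsto_zero.1 hψa
    refine squeeze_zero_norm (fun n => ?_) h0
    refine norm_le_norm_of_abs_le_abs (abs_sub_truncate_le.trans ?_)
    refine sup_le ?_ (abs_nonneg _)
    refine (sub_le_sub_right (hxy _) _).trans ?_
    rw [sub_le_iff_le_add]
    simpa using abs_add_le (y (φ (ψ n)) - a) a
  have h3 : Tendsto (fun n => T (x₁ n - x₂ n) + T (x₂ n)) atTop (𝓝 0) := by
    have := ((T.continuous.tendsto 0).comp hsub)
    rw [map_zero] at this
    simpa using this.add h2
  simp only [← map_add, sub_add_cancel] at h3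
  have := ge_of_tendsto' h3.norm fun n => hφx (ψ n)
  rw [norm_zero] at this
  linarith

end Operators

/-! ### The equivalences. -/

theorem theorem3p12
    {E : Type u} [NormedAddCommGroup E] [NormedSpace ℝ E] [CompleteSpace E]
    [Lattice E] [IsOrderedAddMonoid E] [IsOrderedModule ℝ E] [HasSolidNorm E]
    {Y : Type v} [NormedAddCommGroup Y] [NormedSpace ℝ Y] [CompleteSpace Y]
    (T : E →L[ℝ] Y) :
    [ OrderWeaklyCompact T,
      ∀ S : Set E, IsCompact (closure S) → SLWeaklyCompact S T,
      ∀ v : E, 0 ≤ v → SLWeaklyCompact {v} T,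
      ∀ ε : ℝ, 0 < ε → ∀ v : E, 0 ≤ v →
        ∃ g : StrongDual ℝ E, (∀ x : E, 0 ≤ x → 0 ≤ g x) ∧ ∃ u : E, 0 ≤ u ∧
          ∀ x ∈ Icc (-v) v, ‖T x‖ ≤ g (|x| ⊓ u) + ε,
      ∀ v : E, 0 ≤ v → ∀ (ι : Type w) [Preorder ι] [IsDirectedOrder ι] [Nonempty ι] (x : ι → E),
        (∀ i, x i ∈ Icc (-v) v) → UawTendsto x atTop 0 →
          Tendsto (fun i => T (x i)) atTop (𝓝 0),
      ∀ v : E, 0 ≤ v → ∀ x : ℕ → E,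
        (∀ n, x n ∈ Icc (-v) v) → UawTendsto x atTop 0 →
          Tendsto (fun n => T (x n)) atTop (𝓝 0),
      ∀ A : Set E, OrderBounded A → UawCompact A → IsCompact (T '' A),
      ∀ A : Set E, OrderBounded A → RelativelyUawCompact A → IsCompact (closure (T '' A))
    ].TFAE := by
  have dom_of_disjoint : (∀ v : E, 0 ≤ v → ∀ z : ℕ → E, (∀ n, z n ∈ Icc 0 v) →
      (∀ i j, i ≠ j → z i ⊓ z j = 0) → Tendsto (fun n => T (z n)) atTop (𝓝 0)) →
      ∀ ε : ℝ, 0 < ε → ∀ v : E, 0 ≤ v →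
        ∃ g : StrongDual ℝ E, (∀ x : E, 0 ≤ x → 0 ≤ g x) ∧ ∃ u : E, 0 ≤ u ∧
          ∀ x ∈ Icc (-v) v, ‖T x‖ ≤ g (|x| ⊓ u) + ε := by
    intro h ε hε v hv
    obtain ⟨g, hg, hgT⟩ := exists_nonneg_norm_apply_le_of_tendsto_of_disjoint h hε hv
    refine ⟨g, hg, v, hv, fun x hx => ?_⟩
    rw [inf_eq_left.2 (abs_le'.2 ⟨hx.2, neg_le.1 hx.1⟩)]
    exact hgT x hx
  tfae_have 1 → 4 := fun h =>
    dom_of_disjoint fun v hv z hz hd => h.tendsto_of_disjoint hv hz hd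
  tfae_have 4 → 1 := by
    intro h
    refine orderWeaklyCompact_of_forall_exists_norm_apply_le T fun ε hε v hv => ?_
    obtain ⟨g, hg, u, -, hgu⟩ := h ε hε v hv
    refine ⟨g, hg, fun x hx => (hgu x hx).trans ?_⟩
    have := StrongDual.mono_of_nonneg hg (inf_le_left : |x| ⊓ u ≤ |x|)
    linarith
  tfae_have 2 → 3 := fun h v _ => h {v} (by rw [closure_singleton]; exact isCompact_singleton)
  tfae_have 3 → 2 := fun h S hS => sLWeaklyCompact_of_isCompact_closure h hS
  tfae_have 3 → 6 := by
    intro h v hv x hxv hx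
    refine h v hv x (fun n => ⟨v, rfl, ?_⟩) hx
    rw [abs_of_nonneg hv]
    exact abs_le'.2 ⟨(hxv n).2, neg_le.1 (hxv n).1⟩
  tfae_have 6 → 3 := by
    intro h v hv x hxv hx
    refine h v hv x (fun n => ?_) hx
    obtain ⟨_, rfl, hn⟩ := hxv n
    rw [abs_of_nonneg hv] at hn
    obtain ⟨h1, h2⟩ := abs_le'.1 hn
    exact ⟨neg_le.1 h2, h1⟩
  tfae_have 4 → 5 := fun h v hv ι _ _ _ x hxv hx =>
    tendsto_apply_of_uawTendsto_zero (fun ε hε => h ε hε v hv) hxv hx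
  tfae_have 5 → 6 := by
    intro h v hv x hxv hx
    -- A sequence is a net over a copy of ℕ in the required universe.
    have : IsDirectedOrder (ULift.{w} ℕ) :=
      ⟨fun a b => ⟨⟨max a.down b.down⟩, le_max_left a.down b.down, le_max_right a.down b.down⟩⟩
    have hdown : Tendsto (ULift.down : ULift.{w} ℕ → ℕ) atTop atTop :=
      tendsto_atTop.2 fun n => Ici_mem_atTop (⟨n⟩ : ULift.{w} ℕ)
    have hup : Tendsto (ULift.up : ℕ → ULift.{w} ℕ) atTop atTop :=
      tendsto_atTop.2 fun n => Ici_mem_atTop n.down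
    exact (h v hv (ULift.{w} ℕ) (x ∘ ULift.down) (fun n => hxv _) (hx.comp hdown)).comp hup
  tfae_have 6 → 4 := fun h => dom_of_disjoint fun v hv z hz hd =>
    h v hv z (fun n => ⟨(neg_nonpos.2 hv).trans (hz n).1, (hz n).2⟩)
      (uawTendsto_zero_of_disjoint (fun n => (hz n).1) hd)
  have directed_ulift : IsDirectedOrder (ULift.{u} ℕ) :=
    ⟨fun a b => ⟨⟨max a.down b.down⟩, le_max_left a.down b.down, le_max_right a.down b.down⟩⟩
  tfae_have 4 → 7 := by
    intro h A hA hAc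
    refine IsSeqCompact.isCompact fun y hy => ?_
    choose x hxA hxy using hy
    obtain ⟨a, ha, hxa⟩ := hAc (ULift.{u} ℕ) (fun n => x n.down) fun n => hxA _
    obtain ⟨φ, hφ, hlim⟩ := exists_strictMono_tendsto_of_hasSubnetUawTendsto h hA hxA hxa
    refine ⟨T a, mem_image_of_mem T ha, φ, hφ, ?_⟩
    simpa only [hxy, Function.comp_def] using hlim
  tfae_have 4 → 8 := by
    intro h A hA hAc
    refine isCompact_closure_of_forall_seq fun y hy => ?_
    choose x hxA hxy using hy
    obtain ⟨a, hxa⟩ := hAc (ULift.{u} ℕ) (fun n => x n.down) fun n => hxA _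
    obtain ⟨φ, hφ, hlim⟩ := exists_strictMono_tendsto_of_hasSubnetUawTendsto h hA hxA hxa
    refine ⟨T a, φ, hφ, ?_⟩
    simpa only [hxy, Function.comp_def] using hlim
  tfae_have 7 → 6 := fun h v hv x hxv hx =>
    tendsto_apply_of_forall_isCompact_closure_image
      (fun A hA hAc => (h A hA hAc).closure) hv hxv hx
  tfae_have 8 → 6 := fun h v hv x hxv hx =>
    tendsto_apply_of_forall_isCompact_closure_image
      (fun A hA hAc => h A hA fun ι _ _ _ y hy => (hAc ι y hy).imp fun _ ha => ha.2) hv hxv hx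
  tfae_finish
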